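/- **Setting.** All signals are real and start at time $0$. Let $F$ be a stable, finite-dimensional, strictly proper scalar continuous-time linear time-invariant (LTI) system $F(s)=C(sI-A)^{-1}B$, with all eigenvalues of $A$ in the open left half-plane and zero initial state. Let $h>0$ be the sampling period, and let $\mathbf M=[b_0,\dots,b_{M-1}]$, $b_i\in\{0,1\}$, $M\ge 1$, be a decimation pattern with ones exactly at the positions $i_1<\dots<i_N$. Let $E$ be the $N\times M$ matrix with $(Ev)_r=v_{i_r}$ for $v=(v_0,\dots,v_{M-1})^\top$. Let $\widetilde{\mathcal K}$ be a (causal) discrete-time LTI system with $N$ inputs and $M$ outputs. For $\tau>0$ let $\mathcal S_\tau$ be the ideal sampler, $(\mathcal S_\tau y)_k=y(k\tau)$, and $\mathcal H_\tau$ the zero-order hold, $(\mathcal H_\tau x)(t)=x_k$ for $k\tau\le t<(k+1)\tau$. For an integer $p\ge 1$ let $\mathbf L_p$ be the lifting $(\mathbf L_p x)_k=(x_{kp},x_{kp+1},\dots,x_{kp+p-1})^\top$. The sampled-data error system with reconstruction delay $L$ is $$T_{ew}(\widetilde{\mathcal K},\mathbf M)=\bigl(e^{-Ls}-\mathcal H_h\,\mathbf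 L_M^{-1}\,\widetilde{\mathcal K}\,E\,\mathbf L_M\,\mathcal S_h\bigr)F .$$ For a continuous-time system $\|T\|_\infty=\sup\{\|Tw\|_2/\|w\|_2 : w\in L^2[0,\infty),\ w\ne 0\}\in[0,\infty]$, and for a discrete-time system $\|P\|_\infty$ is the analogous $\ell^2$-induced norm (with the Euclidean norm on vector values). **Theorem.** Assume $L=mh$, where $m$ is a nonnegative integer. For $n\ge 1$ let $F_{d,n}=\mathcal S_{h/n}F\mathcal H_{h/n}$ and $$G_{1,n}=\mathbf L_n z^{-mn}F_{d,n}\mathbf L_n^{-1},\qquad G_{2,n}=[1,1,\dots,1]^\top\in\mathbb R^n,\qquad G_{3,n}=[1,0,\dots,0]\,\mathbf L_nF_{d,n}\mathbf L_n^{-1},$$ $$T_n(\widetilde{\mathcal K},\mathbf M)=\mathbf L_MG_{1,n}\mathbf L_M^{-1}-\bigl(\mathbf L_MG_{2,n}\mathbf L_M^{-1}\bigr)\,\widetilde{\mathcal K}\,E\,\bigl(\mathbf L_MG_{3,n}\mathbf L_M^{-1}\bigr).$$ Then: 1. For every $n\ge 1$, $T_n(\widetilde{\mathcal K},\mathbf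 M)$ is a discrete-time LTI system, it has a finite-dimensional state-space realization whenever $\widetilde{\mathcal K}$ has one, and it is the lifted fast discretization of the error system: $$T_n(\widetilde{\mathcal K},\mathbf M)=\mathbf L_M\mathbf L_n\,\mathcal S_{h/n}\,T_{ew}(\widetilde{\mathcal K},\mathbf M)\,\mathcal H_{h/n}\,\mathbf L_n^{-1}\mathbf L_M^{-1}.$$ 2. $\displaystyle\lim_{n\to\infty}\|T_n(\widetilde{\mathcal K},\mathbf M)\|_\infty=\|T_{ew}(\widetilde{\mathcal K},\mathbf M)\|_\infty$ in $[0,\infty]$, and the right-hand side is finite if $\|\widetilde{\mathcal K}\|_\infty<\infty$. -/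

import Mathlib

open Filter Topology MeasureTheory
open scoped ENNReal

noncomputable section

namespace SampledData

/-! ### Energies and induced norms

Norms are extended nonnegative reals, so that an unbounded system has norm `∞`. -/

/-- Squared Euclidean norm of a value of a discrete-time signal (a real number, a real vector,
or a vector of vectors). -/
class HasEnergy (V : Type) where
  energy : V → ℝ≥0∞

instance : HasEnergy ℝ := ⟨fun x => ‖x‖ₑ ^ 2⟩

instance {ι V : Type} [Fintype ι] [HasEnergy V] : HasEnergy (ι → V) :=
  ⟨fun v => ∑ i, HasEnergy.energy (v i)⟩

/-- The `ℓ²` norm of a discrete-time signal `{x₀, x₁, x₂, …}`. -/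
def l2Norm {V : Type} [HasEnergy V] (x : ℕ → V) : ℝ≥0∞ :=
  (∑' k, HasEnergy.energy (x k)) ^ (1 / 2 : ℝ)

/-- The `H^∞` norm (`ℓ²`-induced norm) of a discrete-time system. -/
def discreteHinfNorm {V W : Type} [HasEnergy V] [HasEnergy W] (P : (ℕ → V) → (ℕ → W)) : ℝ≥0∞ :=
  ⨆ (u : ℕ → V) (_ : l2Norm u ≠ 0) (_ : l2Norm u ≠ ∞), l2Norm (P u) / l2Norm u

/-- Lebesgue measure on the time axis `[0, ∞)`. -/
def timeMeasure : Measure ℝ := volume.restrict (Set.Ici 0)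

/-- The `H^∞` norm (`L²`-induced norm) of a continuous-time system: the supremum of
`‖T w‖₂ / ‖w‖₂` over the nonzero `w ∈ L²[0, ∞)`. -/
def continuousHinfNorm (T : (ℝ → ℝ) → (ℝ → ℝ)) : ℝ≥0∞ :=
  ⨆ (w : ℝ → ℝ) (_ : MemLp w 2 timeMeasure) (_ : eLpNorm w 2 timeMeasure ≠ 0),
    eLpNorm (T w) 2 timeMeasure / eLpNorm w 2 timeMeasure

/-! ### Discrete-time systems -/

/-- The delay `z^{-k}`. -/
def delay {V : Type} [Zero V] (k : ℕ) (x : ℕ → V) : ℕ → V :=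
  fun j => if j < k then 0 else x (j - k)

/-- Linear time-invariant discrete-time systems. Signals start at time `0`, so commutation with
the unit delay also makes the system causal. -/
structure IsLTI {V W : Type} [AddCommGroup V] [Module ℝ V] [AddCommGroup W] [Module ℝ W]
    (P : (ℕ → V) → (ℕ → W)) : Prop where
  map_add : ∀ u v, P (u + v) = P u + P v
  map_smul : ∀ (c : ℝ) (u), P (c • u) = c • P u
  map_delay : ∀ u, P (delay 1 u) = delay 1 (P u)

/-- A state-space system `x (k+1) = A x k + B u k`, `y k = C x k + D u k` with
finite-dimensional state. -/
structure StateSpace (V W : Type) [AddCommGroup V] [Module ℝ V] [AddCommGroup W] [Module ℝ W] where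
  dim : ℕ
  A : (Fin dim → ℝ) →ₗ[ℝ] (Fin dim → ℝ)
  B : V →ₗ[ℝ] (Fin dim → ℝ)
  C : (Fin dim → ℝ) →ₗ[ℝ] W
  D : V →ₗ[ℝ] W

namespace StateSpace

variable {V W : Type} [AddCommGroup V] [Module ℝ V] [AddCommGroup W] [Module ℝ W]

/-- State trajectory from the zero initial state. -/
def state (G : StateSpace V W) (u : ℕ → V) : ℕ → (Fin G.dim → ℝ)
  | 0 => 0
  | k + 1 => G.A (state G u k) + G.B (u k)

/-- Input-output map of a state-space system. -/
def output (G : StateSpace V W) (u : ℕ → V) : ℕ → W :=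
  fun k => G.C (G.state u k) + G.D (u k)

end StateSpace

/-- The system has a finite-dimensional state-space realization. -/
def IsFiniteDimensional {V W : Type} [AddCommGroup V] [Module ℝ V] [AddCommGroup W] [Module ℝ W]
    (P : (ℕ → V) → (ℕ → W)) : Prop :=
  ∃ G : StateSpace V W, ∀ u, P u = G.output u

/-- Discrete-time lifting (polyphase decomposition) `𝐋_n`: groups `n` successive samples. -/
def dlift {V : Type} (n : ℕ) (x : ℕ → V) : ℕ → (Fin n → V) :=
  fun k i => x (k * n + i)

/-- The inverse lifting `𝐋_n⁻¹`. -/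
def idlift {V : Type} (n : ℕ) [NeZero n] (y : ℕ → (Fin n → V)) : ℕ → V :=
  fun k => y (k / n) (Fin.ofNat n k)

/-- The lifted system `𝐋_n P 𝐋_n⁻¹`. -/
def lift {V W : Type} (n : ℕ) [NeZero n] (P : (ℕ → V) → (ℕ → W)) :
    (ℕ → (Fin n → V)) → (ℕ → (Fin n → W)) :=
  fun u => dlift n (P (idlift n u))

/-! ### Continuous-time systems, sampling and hold -/

/-- A strictly proper finite-dimensional scalar system with transfer function `C (sI - A)⁻¹ B`. -/
structure CTSystem where
  dim : ℕ
  A : Matrix (Fin dim) (Fin dim) ℝ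
  B : Fin dim → ℝ
  C : Fin dim → ℝ

/-- Stability: all eigenvalues of `A` lie in the open left half-plane. -/
def CTSystem.IsStable (F : CTSystem) : Prop :=
  ∀ z ∈ spectrum ℂ (F.A.map (algebraMap ℝ ℂ)), z.re < 0

/-- The response `∫₀ᵗ C e^{(t-s)A} B w(s) ds` from the zero initial state. -/
def CTSystem.response (F : CTSystem) (w : ℝ → ℝ) : ℝ → ℝ :=
  fun t => ∫ s in (0 : ℝ)..t, (F.C ⬝ᵥ (NormedSpace.exp ((t - s) • F.A)).mulVec F.B) * w s

/-- The continuous-time delay `e^{-Ls}`. -/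
def ctDelay (L : ℝ) (y : ℝ → ℝ) : ℝ → ℝ :=
  fun t => if t < L then 0 else y (t - L)

/-- The ideal sampler with period `τ`. -/
def sampler (τ : ℝ) (y : ℝ → ℝ) : ℕ → ℝ :=
  fun k => y (k * τ)

/-- The zero-order hold with period `τ` (on the time axis `t ≥ 0`). -/
def hold (τ : ℝ) (x : ℕ → ℝ) : ℝ → ℝ :=
  fun t => x ⌊t / τ⌋₊

/-- Step-invariant discretization: hold, continuous-time system, sampler. -/
def ctd (τ : ℝ) (P : (ℝ → ℝ) → (ℝ → ℝ)) : (ℕ → ℝ) → (ℕ → ℝ) :=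
  fun u => sampler τ (P (hold τ u))

/-! ### The decimation pattern and the error system -/

/-- The positions of the ones of a decimation pattern `[b_0, …, b_{M-1}]`. -/
def ones {M : ℕ} (b : Fin M → Bool) : Finset (Fin M) :=
  Finset.univ.filter fun i => b i = true

/-- The number `N` of ones of a decimation pattern. -/
def numOnes {M : ℕ} (b : Fin M → Bool) : ℕ := (ones b).card

/-- The `N × M` selection matrix `E`, whose `r`-th row has its single `1` at the `r`-th (in
increasing order) position of a one of the pattern. -/
def selection {M : ℕ} (b : Fin M → Bool) : Matrix (Fin (numOnes b)) (Fin M) ℝ :=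
  Matrix.of fun r j => if j = (ones b).orderEmbOfFin rfl r then 1 else 0

/-- The memoryless system given by the matrix `E`. -/
def select {M : ℕ} (b : Fin M → Bool) (x : ℕ → (Fin M → ℝ)) : ℕ → (Fin (numOnes b) → ℝ) :=
  fun k => (selection b).mulVec (x k)

/-- The sampled-data error system
`T_ew = (e^{-Ls} - 𝓗_h 𝐋_M⁻¹ K̃ E 𝐋_M 𝓢_h) F`. -/
def errorSystem (F : CTSystem) (h L : ℝ) {M : ℕ} [NeZero M] (b : Fin M → Bool)
    (K : (ℕ → (Fin (numOnes b) → ℝ)) → (ℕ → (Fin M → ℝ))) : (ℝ → ℝ) → (ℝ → ℝ) :=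
  fun w t => ctDelay L (F.response w) t -
    hold h (idlift M (K (select b (dlift M (sampler h (F.response w)))))) t

/-! ### The fast-sampling/fast-hold approximations -/

/-- `G_{1,n}`: the lifting by `n` of `z^{-mn} F_d`, with `F_d` the discretization of `F` with
period `h / n`. -/
def G1 (F : CTSystem) (h : ℝ) (m n : ℕ) [NeZero n] : (ℕ → (Fin n → ℝ)) → (ℕ → (Fin n → ℝ)) :=
  lift n fun u => delay (m * n) (ctd (h / n) F.response u)

/-- `G_{2,n}`: the memoryless system given by the column `[1, …, 1]ᵀ` of length `n`. -/
def G2 (n : ℕ) (x : ℕ → ℝ) : ℕ → (Fin n → ℝ) :=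
  fun k _ => x k

/-- `G_{3,n}`: the first component of the lifting by `n` of the discretization of `F` with
period `h / n`. -/
def G3 (F : CTSystem) (h : ℝ) (n : ℕ) [NeZero n] : (ℕ → (Fin n → ℝ)) → (ℕ → ℝ) :=
  fun u k => lift n (ctd (h / n) F.response) u k 0

/-- `T_n = 𝐋_M(G_{1,n}) - 𝐋_M(G_{2,n}) K̃ E 𝐋_M(G_{3,n})`. -/
def fastSystem (F : CTSystem) (h : ℝ) (m : ℕ) {M : ℕ} [NeZero M] (b : Fin M → Bool)
    (K : (ℕ → (Fin (numOnes b) → ℝ)) → (ℕ → (Fin M → ℝ))) (n : ℕ) [NeZero n] :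
    (ℕ → (Fin M → Fin n → ℝ)) → (ℕ → (Fin M → Fin n → ℝ)) :=
  fun u => lift M (G1 F h m n) u - lift M (G2 n) (K (select b (lift M (G3 F h n) u)))

end SampledData

end

namespace SampledData

/-! ### Lifting -/

section Lifting

variable {V W : Type}

/-! Write T for the error system, τ = h/n, S and H for sampler and hold of period τ, and y = Fw.
Discrete lifting is a bijection preserving energy, so T_n has the norm of S T H (`fastSystem_eq`,
`discreteHinfNorm_lift`). The hold is √τ times an isometry (`eLpNorm_hold`), so that norm is the
supremum of ‖H S T w‖/‖w‖ over nonzero held inputs w. Everything therefore rests on comparing T w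
with H S T w.

The reconstructed signal is constant on intervals of length h, and L is a multiple of τ. Hence T w −
H S T w is just the delayed version of y − H S y (`errorSystem_sub_hold_sampler`), in which the
filter no longer appears. The impulse response and its derivative decay exponentially, so Young's
inequality gives ‖y − H S y‖ ≤ cτ‖w‖ with c independent of n (`exists_response_sub_hold_bound`).

Upper bound: the triangle inequality yields ‖T_n‖ ≤ ‖T‖ + cτ. Lower bound: if ‖T_n‖ ≤ a < ∞ for
arbitrarily large n, then ‖T w‖ ≤ (a + cτ)‖w‖ for the corresponding held inputs. Held samples
approximate continuous compactly supported signals, which are dense in L². At each instant T w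
depends continuously on w: by causality the filter output there is a linear function of finitely
many samples. Fatou's lemma then gives ‖T‖ ≤ a. The filter is never assumed bounded, so the case ‖T‖
= ∞ is included. -/

lemma dlift_idlift (n : ℕ) [NeZero n] (y : ℕ → Fin n → V) : dlift n (idlift n y) = y := by
  funext k i
  have hn : 0 < n := Nat.pos_of_neZero n
  have h1 : (k * n + (i : ℕ)) / n = k := by
    rw [Nat.mul_comm, Nat.mul_add_div hn, Nat.div_eq_of_lt i.isLt, Nat.add_zero]
  have h2 : Fin.ofNat n (k * n + (i : ℕ)) = i := by
    ext
    simp [Fin.ofNat, Nat.mod_eq_of_lt i.isLt]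
  simp only [dlift, idlift, h1, h2]

lemma idlift_dlift (n : ℕ) [NeZero n] (x : ℕ → V) : idlift n (dlift n x) = x := by
  funext k
  simp only [dlift, idlift, Fin.val_ofNat]
  rw [Nat.div_add_mod']

lemma idlift_apply (n : ℕ) [NeZero n] (y : ℕ → Fin n → V) (k : ℕ) (i : Fin n) :
    idlift n y (k * n + i) = y k i :=
  congrFun (congrFun (dlift_idlift n y) k) i

lemma lift_apply (n : ℕ) [NeZero n] (P : (ℕ → V) → (ℕ → W)) (u : ℕ → Fin n → V) (k : ℕ)
    (i : Fin n) : lift n P u k i = P (idlift n u) (k * n + i) := rfl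

lemma delay_zero [Zero V] (x : ℕ → V) : delay 0 x = x := by
  funext k; simp [delay]

lemma delay_add [Zero V] (a b : ℕ) (x : ℕ → V) : delay (a + b) x = delay a (delay b x) := by
  funext k
  simp only [delay]
  split_ifs <;> first | rfl | omega | (congr 1; omega)

end Lifting

/-! ### Energies -/

section Energy

variable {V W : Type} [HasEnergy V] [HasEnergy W]

lemma energy_real (x : ℝ) : HasEnergy.energy x = ‖x‖ₑ ^ 2 := rfl

lemma energy_pi {ι : Type} [Fintype ι] (v : ι → V) :
    HasEnergy.energy v = ∑ i, HasEnergy.energy (v i) := rfl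

lemma tsum_energy_dlift (n : ℕ) [NeZero n] (x : ℕ → V) :
    ∑' k, HasEnergy.energy (dlift n x k) = ∑' k, HasEnergy.energy (x k) := by
  rw [← (Nat.divModEquiv n).symm.tsum_eq fun j => HasEnergy.energy (x j),
    ENNReal.summable.tsum_prod' fun _ => ENNReal.summable]
  refine tsum_congr fun k => ?_
  rw [energy_pi, tsum_fintype]
  rfl

lemma l2Norm_dlift (n : ℕ) [NeZero n] (x : ℕ → V) : l2Norm (dlift n x) = l2Norm x := by
  rw [l2Norm, l2Norm, tsum_energy_dlift]

lemma l2Norm_idlift (n : ℕ) [NeZero n] (x : ℕ → Fin n → V) : l2Norm (idlift n x) = l2Norm x := by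
  rw [← l2Norm_dlift n, dlift_idlift]

/-- Lifting is an energy-preserving bijection, so the supremum can be reindexed along `dlift`. -/
lemma discreteHinfNorm_lift (n : ℕ) [NeZero n] (P : (ℕ → V) → (ℕ → W)) :
    discreteHinfNorm (lift n P) = discreteHinfNorm P := by
  have hs : Function.Surjective (dlift (V := V) n) := fun y => ⟨idlift n y, dlift_idlift n y⟩
  rw [discreteHinfNorm, ← hs.iSup_comp]
  simp only [l2Norm_dlift, lift, idlift_dlift]
  rfl

lemma l2Norm_le_discreteHinfNorm_mul (P : (ℕ → V) → (ℕ → W)) {u : ℕ → V} (h0 : l2Norm u ≠ 0)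
    (h1 : l2Norm u ≠ ∞) : l2Norm (P u) ≤ discreteHinfNorm P * l2Norm u := by
  rw [← ENNReal.div_le_iff h0 h1]
  exact le_iSup₂_of_le u h0 (le_iSup_of_le h1 le_rfl)

lemma l2Norm_real (x : ℕ → ℝ) : l2Norm x = (∑' k, ‖x k‖ₑ ^ 2) ^ (1 / 2 : ℝ) := rfl

lemma l2Norm_mono {x : ℕ → V} {y : ℕ → W}
    (h : ∀ k, HasEnergy.energy (x k) ≤ HasEnergy.energy (y k)) : l2Norm x ≤ l2Norm y :=
  ENNReal.rpow_le_rpow (ENNReal.tsum_le_tsum h) (by norm_num)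

lemma selection_mulVec {M : ℕ} (b : Fin M → Bool) (v : Fin M → ℝ) (r : Fin (numOnes b)) :
    (selection b).mulVec v r = v ((ones b).orderEmbOfFin rfl r) := by
  simp [selection, Matrix.mulVec, dotProduct]

/-- The selected positions are distinct, so the energy kept is a subsum of the whole energy. -/
lemma l2Norm_select_le {M : ℕ} (b : Fin M → Bool) (x : ℕ → Fin M → ℝ) :
    l2Norm (select b x) ≤ l2Norm x := by
  refine l2Norm_mono fun k => ?_
  simp only [energy_pi, select, selection_mulVec]
  exact (Finset.sum_map Finset.univ ((ones b).orderEmbOfFin rfl).toEmbedding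
    fun i => HasEnergy.energy (x k i)).symm.trans_le
      (Finset.sum_le_sum_of_subset (Finset.subset_univ _))

lemma l2Norm_eq_zero {ι : Type} [Fintype ι] {x : ℕ → ι → ℝ} (h : l2Norm x = 0) : x = 0 := by
  rw [l2Norm, ENNReal.rpow_eq_zero_iff_of_pos (by norm_num), ENNReal.tsum_eq_zero] at h
  funext k i
  have := h k
  rw [energy_pi, Finset.sum_eq_zero_iff] at this
  simpa [energy_real] using this i (Finset.mem_univ i)

end Energy

/-! ### Linear time-invariant systems -/

section LTI

variable {U V W : Type} [AddCommGroup U] [Module ℝ U] [AddCommGroup V] [Module ℝ V]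
  [AddCommGroup W] [Module ℝ W]

lemma delay_map_sub {V : Type} [AddCommGroup V] (k : ℕ) (u v : ℕ → V) : delay k (u - v) = delay k u - delay k v := by
  funext j
  simp only [delay, Pi.sub_apply]
  split_ifs <;> simp

namespace IsLTI

variable {P : (ℕ → V) → (ℕ → W)}

lemma map_zero (hP : IsLTI P) : P 0 = 0 := by
  simpa using hP.map_smul 0 0

lemma map_sub (hP : IsLTI P) (u v : ℕ → V) : P (u - v) = P u - P v := by
  rw [sub_eq_add_neg, ← neg_one_smul ℝ v, hP.map_add, hP.map_smul, neg_one_smul, ← sub_eq_add_neg]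

lemma map_delay_iter (hP : IsLTI P) (k : ℕ) (u : ℕ → V) : P (delay k u) = delay k (P u) := by
  induction k with
  | zero => simp only [delay_zero]
  | succ k ih => rw [Nat.add_comm, delay_add, hP.map_delay, ih, ← delay_add]

lemma comp {Q : (ℕ → U) → (ℕ → V)} (hP : IsLTI P) (hQ : IsLTI Q) : IsLTI fun u => P (Q u) where
  map_add u v := by rw [hQ.map_add, hP.map_add]
  map_smul c u := by rw [hQ.map_smul, hP.map_smul]
  map_delay u := by rw [hQ.map_delay, hP.map_delay]

lemma sub {Q : (ℕ → V) → (ℕ → W)} (hP : IsLTI P) (hQ : IsLTI Q) :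
    IsLTI fun u => P u - Q u where
  map_add u v := by rw [hP.map_add, hQ.map_add]; abel
  map_smul c u := by rw [hP.map_smul, hQ.map_smul, smul_sub]
  map_delay u := by rw [hP.map_delay, hQ.map_delay, delay_map_sub]

/-- Causality of linear time-invariant systems. -/
lemma causal (hP : IsLTI P) {u v : ℕ → V} {k : ℕ} (h : ∀ j ≤ k, u j = v j) : P u k = P v k := by
  -- The difference vanishes up to time k, so it is some signal delayed by k + 1, and so is its
  -- image.
  have h1 : u - v = SampledData.delay (k + 1) fun j => (u - v) (j + (k + 1)) := by
    funext j
    simp only [SampledData.delay]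
    split_ifs with hj
    · simp [h j (Nat.lt_succ_iff.1 hj)]
    · rw [Nat.sub_add_cancel (not_lt.1 hj)]
  have h2 := congrFun (hP.map_sub u v) k
  rw [h1, hP.map_delay_iter] at h2
  simpa [SampledData.delay, sub_eq_zero, eq_comm] using h2

/-- Linear time-invariant systems are continuous for pointwise convergence of signals. -/
lemma tendsto {ι κ α : Type} [Fintype ι] [Fintype κ] {Q : (ℕ → ι → ℝ) → (ℕ → κ → ℝ)}
    (hQ : IsLTI Q) {l : Filter α} {u : α → ℕ → ι → ℝ} {v : ℕ → ι → ℝ}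
    (h : ∀ j, Tendsto (fun a => u a j) l (𝓝 (v j))) (k : ℕ) :
    Tendsto (fun a => Q (u a) k) l (𝓝 (Q v k)) := by
  -- By causality the output at time k factors through the first k + 1 inputs. A linear map on that
  -- finite-dimensional space is automatically continuous, with no bound on Q.
  let ext : (Fin (k + 1) → ι → ℝ) → ℕ → ι → ℝ := fun x j =>
    if hj : j < k + 1 then x ⟨j, hj⟩ else 0
  let φ : (Fin (k + 1) → ι → ℝ) →ₗ[ℝ] (κ → ℝ) :=
    { toFun := fun x => Q (ext x) k
      map_add' := fun x y => by
        have : ext (x + y) = ext x + ext y := by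
          funext j
          simp only [ext, Pi.add_apply]
          split_ifs <;> simp
        rw [this, hQ.map_add, Pi.add_apply]
      map_smul' := fun c x => by
        have : ext (c • x) = c • ext x := by
          funext j
          simp only [ext, Pi.smul_apply]
          split_ifs <;> simp
        rw [this, hQ.map_smul, Pi.smul_apply, RingHom.id_apply] }
  have key : ∀ x : ℕ → ι → ℝ, Q x k = φ fun j => x j := fun x =>
    hQ.causal fun j hj => by
      simp only [ext, dif_pos (Nat.lt_succ_of_le hj)]
  simp only [key]
  exact (φ.continuous_of_finiteDimensional.tendsto _).comp (tendsto_pi_nhds.2 fun j => h j)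

end IsLTI

end LTI

/-! ### Finite-dimensional systems -/

section FiniteDim

variable {U V W : Type} [AddCommGroup U] [Module ℝ U] [AddCommGroup V] [Module ℝ V]
  [AddCommGroup W] [Module ℝ W]

/-- Allows any finite-dimensional state space, such as a product for interconnections; a basis
transports it to coordinates. -/
lemma isFiniteDimensional_of_realization {X : Type} [AddCommGroup X] [Module ℝ X]
    [FiniteDimensional ℝ X] (A : X →ₗ[ℝ] X) (B : V →ₗ[ℝ] X) (C : X →ₗ[ℝ] W) (D : V →ₗ[ℝ] W)
    {P : (ℕ → V) → (ℕ → W)}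
    (h : ∀ u, ∃ x : ℕ → X, x 0 = 0 ∧ (∀ k, x (k + 1) = A (x k) + B (u k)) ∧
      ∀ k, P u k = C (x k) + D (u k)) : IsFiniteDimensional P := by
  let e : X ≃ₗ[ℝ] (Fin (Module.finrank ℝ X) → ℝ) := (Module.finBasis ℝ X).equivFun
  let G : StateSpace V W :=
    ⟨Module.finrank ℝ X, e.toLinearMap ∘ₗ A ∘ₗ e.symm.toLinearMap, e.toLinearMap ∘ₗ B,
      C ∘ₗ e.symm.toLinearMap, D⟩
  refine ⟨G, fun u => ?_⟩
  obtain ⟨x, h0, h1, h2⟩ := h u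
  have hx : ∀ k, G.state u k = e (x k) := by
    intro k
    induction k with
    | zero => simp [StateSpace.state, h0]
    | succ k ih => simp [StateSpace.state, ih, h1, G]
  funext k
  rw [StateSpace.output, hx, h2]
  simp [G]

namespace IsFiniteDimensional

variable {P : (ℕ → V) → (ℕ → W)}

lemma isLTI (hP : IsFiniteDimensional P) : IsLTI P := by
  obtain ⟨G, hG⟩ := hP
  have hadd : ∀ u v, G.state (u + v) = G.state u + G.state v := by
    intro u v
    funext k
    induction k with
    | zero => simp [StateSpace.state]
    | succ k ih =>
      simp only [StateSpace.state, ih, Pi.add_apply, _root_.map_add]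
      abel
  have hsmul : ∀ (c : ℝ) u, G.state (c • u) = c • G.state u := by
    intro c u
    funext k
    induction k with
    | zero => simp [StateSpace.state]
    | succ k ih => simp only [StateSpace.state, ih, Pi.smul_apply, _root_.map_smul, smul_add]
  have hdelay : ∀ u k, G.state (delay 1 u) k = delay 1 (G.state u) k := by
    intro u k
    induction k with
    | zero => simp [StateSpace.state, delay]
    | succ k ih =>
      rw [StateSpace.state, ih]
      rcases k with _ | k <;> simp [StateSpace.state, delay]
  refine ⟨fun u v => ?_, fun c u => ?_, fun u => ?_⟩
  · funext k
    simp only [hG, StateSpace.output, hadd, Pi.add_apply, _root_.map_add]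
    abel
  · funext k
    simp only [hG, StateSpace.output, hsmul, Pi.smul_apply, _root_.map_smul, smul_add]
  · funext k
    simp only [hG, StateSpace.output, hdelay]
    rcases k with _ | k <;> simp [StateSpace.output, delay]

lemma comp {Q : (ℕ → U) → (ℕ → V)} (hP : IsFiniteDimensional P) (hQ : IsFiniteDimensional Q) :
    IsFiniteDimensional fun u => P (Q u) := by
  obtain ⟨G, hG⟩ := hP
  obtain ⟨H, hH⟩ := hQ
  refine isFiniteDimensional_of_realization (X := (Fin H.dim → ℝ) × (Fin G.dim → ℝ))
    ((H.A ∘ₗ LinearMap.fst ℝ _ _).prod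
      (G.A ∘ₗ LinearMap.snd ℝ _ _ + G.B ∘ₗ H.C ∘ₗ LinearMap.fst ℝ _ _))
    (H.B.prod (G.B ∘ₗ H.D)) (G.C ∘ₗ LinearMap.snd ℝ _ _ + G.D ∘ₗ H.C ∘ₗ LinearMap.fst ℝ _ _)
    (G.D ∘ₗ H.D) fun u => ⟨fun k => (H.state u k, G.state (Q u) k), rfl, fun k => ?_, fun k => ?_⟩
  · ext i
    · simp [StateSpace.state]
    · simp [StateSpace.state, hH, StateSpace.output, add_assoc]
  · simp [hG, hH, StateSpace.output, add_assoc]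

lemma sub {Q : (ℕ → V) → (ℕ → W)} (hP : IsFiniteDimensional P) (hQ : IsFiniteDimensional Q) :
    IsFiniteDimensional fun u => P u - Q u := by
  obtain ⟨G, hG⟩ := hP
  obtain ⟨H, hH⟩ := hQ
  refine isFiniteDimensional_of_realization (X := (Fin G.dim → ℝ) × (Fin H.dim → ℝ))
    (G.A.prodMap H.A) (G.B.prod H.B) (G.C ∘ₗ LinearMap.fst ℝ _ _ - H.C ∘ₗ LinearMap.snd ℝ _ _)
    (G.D - H.D) fun u => ⟨fun k => (G.state u k, H.state u k), rfl, fun k => ?_, fun k => ?_⟩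
  · simp [StateSpace.state]
  · simp only [hG, hH, StateSpace.output, Pi.sub_apply, LinearMap.sub_apply, LinearMap.comp_apply,
      LinearMap.fst_apply, LinearMap.snd_apply]
    abel

lemma memoryless (D : V →ₗ[ℝ] W) : IsFiniteDimensional fun (u : ℕ → V) k => D (u k) :=
  isFiniteDimensional_of_realization (X := Fin 0 → ℝ) 0 0 0 D fun _ => ⟨0, rfl, by simp, by simp⟩

lemma delay [FiniteDimensional ℝ V] (k : ℕ) :
    IsFiniteDimensional fun u : ℕ → V => delay k u := by
  induction k with
  | zero => simpa only [delay_zero, LinearMap.id_apply] using memoryless (LinearMap.id (R := ℝ) (M := V))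
  | succ k ih =>
    simp only [delay_add]
    -- The state of a unit delay is the previous input.
    refine ih.comp (isFiniteDimensional_of_realization (X := V) 0 LinearMap.id LinearMap.id 0
      fun u => ⟨SampledData.delay 1 u, rfl, fun k => ?_, fun k => ?_⟩) <;>
    simp [SampledData.delay]

lemma lift (n : ℕ) [NeZero n] (hP : IsFiniteDimensional P) : IsFiniteDimensional (lift n P) := by
  obtain ⟨G, hG⟩ := hP
  -- `Φ i` sends the state at the start of a block, together with the block of inputs, to the state
  -- i steps later. The lifted system keeps the same state space, observed at block starts.
  let Φ : ℕ → ((Fin G.dim → ℝ) × (Fin n → V)) →ₗ[ℝ] (Fin G.dim → ℝ) := fun i =>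
    Nat.rec (LinearMap.fst ℝ _ _)
      (fun i Ψ => G.A ∘ₗ Ψ + G.B ∘ₗ LinearMap.proj (Fin.ofNat n i) ∘ₗ LinearMap.snd ℝ _ _) i
  have hΦ : ∀ u k i, i ≤ n →
      G.state (idlift n u) (k * n + i) = Φ i (G.state (idlift n u) (k * n), u k) := by
    intro u k i hi
    induction i with
    | zero => rfl
    | succ i ih =>
      have h1 : idlift n u (k * n + i) = u k (Fin.ofNat n i) := by
        have := idlift_apply n u k (Fin.ofNat n i)
        rwa [Fin.val_ofNat, Nat.mod_eq_of_lt hi] at this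
      rw [← Nat.add_assoc, StateSpace.state, ih (by omega), h1]
      rfl
  refine isFiniteDimensional_of_realization (X := Fin G.dim → ℝ)
    (Φ n ∘ₗ LinearMap.inl ℝ _ _) (Φ n ∘ₗ LinearMap.inr ℝ _ _)
    (LinearMap.pi fun i : Fin n => G.C ∘ₗ Φ i ∘ₗ LinearMap.inl ℝ _ _)
    (LinearMap.pi fun i : Fin n => G.C ∘ₗ Φ i ∘ₗ LinearMap.inr ℝ _ _ + G.D ∘ₗ LinearMap.proj i)
    fun u => ⟨fun k => G.state (idlift n u) (k * n), by simp [StateSpace.state], fun k => ?_,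
      fun k => ?_⟩
  · beta_reduce
    rw [Nat.succ_mul, hΦ u k n le_rfl, LinearMap.comp_apply, LinearMap.comp_apply,
      ← _root_.map_add]
    simp
  · funext i
    rw [lift_apply, hG, StateSpace.output, hΦ u k i i.isLt.le, idlift_apply]
    simp only [Pi.add_apply, LinearMap.pi_apply, LinearMap.comp_apply, LinearMap.add_apply,
      LinearMap.proj_apply]
    rw [← add_assoc, ← _root_.map_add, ← _root_.map_add]
    simp

end IsFiniteDimensional

end FiniteDim

/-! ### Exponential decay of the impulse response -/

open scoped Matrix.Norms.Operator in
lemma hasSum_exp_mulVec {n : ℕ} (N : Matrix (Fin n) (Fin n) ℂ) (v : Fin n → ℂ) :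
    HasSum (fun j : ℕ => ((j.factorial : ℂ)⁻¹) • (N ^ j).mulVec v) ((NormedSpace.exp N).mulVec v) := by
  have h := NormedSpace.exp_series_hasSum_exp' (𝕂 := ℂ) N
  let ℓ : Matrix (Fin n) (Fin n) ℂ →ₗ[ℂ] (Fin n → ℂ) :=
    { toFun := fun X => X.mulVec v
      map_add' := fun X Y => Matrix.add_mulVec X Y v
      map_smul' := fun c X => Matrix.smul_mulVec c X v }
  have := h.map ℓ ℓ.continuous_of_finiteDimensional
  simp only [Function.comp_def, ℓ, LinearMap.coe_mk, AddHom.coe_mk, Matrix.smul_mulVec] at this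
  convert this <;> rfl

open scoped Matrix.Norms.Operator in
lemma exp_map_complex {n : ℕ} (A : Matrix (Fin n) (Fin n) ℝ) :
    (NormedSpace.exp A).map (algebraMap ℝ ℂ) = NormedSpace.exp (A.map (algebraMap ℝ ℂ)) := by
  have hc : Continuous ((algebraMap ℝ ℂ).mapMatrix : Matrix (Fin n) (Fin n) ℝ →+* _) := by
    change Continuous fun X : Matrix (Fin n) (Fin n) ℝ => X.map (algebraMap ℝ ℂ)
    exact continuous_id.matrix_map (continuous_algebraMap ℝ ℂ)
  convert NormedSpace.map_exp ((algebraMap ℝ ℂ).mapMatrix) hc A <;> rfl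


open scoped Matrix.Norms.Operator in
-- Differentiation only replaces v by A v, so a decay estimate valid for every vector also controls
-- derivatives.
lemma hasDerivAt_dotProduct_exp_mulVec {n : ℕ} (A : Matrix (Fin n) (Fin n) ℝ) (c v : Fin n → ℝ)
    (t : ℝ) : HasDerivAt (fun t : ℝ => c ⬝ᵥ (NormedSpace.exp (t • A)).mulVec v)
      (c ⬝ᵥ (NormedSpace.exp (t • A)).mulVec (A.mulVec v)) t := by
  have h := hasDerivAt_exp_smul_const A t
  let ℓ : Matrix (Fin n) (Fin n) ℝ →ₗ[ℝ] ℝ :=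
    { toFun := fun X => c ⬝ᵥ X.mulVec v
      map_add' := fun X Y => by rw [Matrix.add_mulVec, dotProduct_add]
      map_smul' := fun r X => by rw [Matrix.smul_mulVec, dotProduct_smul, RingHom.id_apply] }
  have := (ℓ.toContinuousLinearMap.hasFDerivAt).comp_hasDerivAt t h
  rw [Matrix.mulVec_mulVec]
  exact this

/-- Exponential decay on the time axis `[0, ∞)`. -/
def ExpDecays {E : Type} [NormedAddCommGroup E] (f : ℝ → E) : Prop :=
  ∃ r > 0, ∃ c ≥ 0, ∀ t : ℝ, 0 ≤ t → ‖f t‖ ≤ c * Real.exp (-(r * t))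

namespace ExpDecays

variable {E E' : Type} [NormedAddCommGroup E] [NormedAddCommGroup E']

lemma zero : ExpDecays fun _ => (0 : E) :=
  ⟨1, one_pos, 0, le_rfl, fun t _ => by simp⟩

lemma add {f g : ℝ → E} (hf : ExpDecays f) (hg : ExpDecays g) : ExpDecays fun t => f t + g t := by
  obtain ⟨r, hr, c, hc, h⟩ := hf
  obtain ⟨s, hs, d, hd, h'⟩ := hg
  refine ⟨min r s, lt_min hr hs, c + d, by positivity, fun t ht => ?_⟩
  have h1 : Real.exp (-(r * t)) ≤ Real.exp (-(min r s * t)) := by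
    gcongr; exact min_le_left _ _
  have h2 : Real.exp (-(s * t)) ≤ Real.exp (-(min r s * t)) := by
    gcongr; exact min_le_right _ _
  calc ‖f t + g t‖ ≤ c * Real.exp (-(r * t)) + d * Real.exp (-(s * t)) :=
        norm_add_le_of_le (h t ht) (h' t ht)
    _ ≤ c * Real.exp (-(min r s * t)) + d * Real.exp (-(min r s * t)) := by gcongr
    _ = _ := by ring

lemma sum {ι : Type} (s : Finset ι) {f : ι → ℝ → E} (hf : ∀ i ∈ s, ExpDecays (f i)) :
    ExpDecays fun t => ∑ i ∈ s, f i t := by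
  classical
  induction s using Finset.induction_on with
  | empty => simpa using zero
  | insert a s ha ih =>
    simp only [Finset.sum_insert ha]
    exact (hf a (Finset.mem_insert_self _ _)).add
      (ih fun i hi => hf i (Finset.mem_insert_of_mem hi))

lemma of_norm_le {f : ℝ → E} {g : ℝ → E'} (hf : ExpDecays f) (C : ℝ)
    (h : ∀ t, ‖g t‖ ≤ C * ‖f t‖) : ExpDecays g := by
  obtain ⟨r, hr, c, hc, hf⟩ := hf
  refine ⟨r, hr, |C| * c, by positivity, fun t ht => (h t).trans ?_⟩
  rw [mul_assoc]
  exact mul_le_mul (le_abs_self C) (hf t ht) (norm_nonneg _) (abs_nonneg C)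

/-- Half of the decay rate absorbs the polynomial factor, through (rt)^j / j! ≤ e^{rt}; the other
half survives. -/
lemma pow_mul_cexp (j : ℕ) {μ : ℂ} (hμ : μ.re < 0) :
    ExpDecays fun t : ℝ => (t : ℂ) ^ j * Complex.exp (t * μ) := by
  set r := -μ.re / 2 with hr
  have hr0 : 0 < r := by rw [hr]; linarith
  refine ⟨r, hr0, j.factorial / r ^ j, by positivity, fun t ht => ?_⟩
  have h1 := Real.pow_div_factorial_le_exp (r * t) (by positivity) j
  rw [div_le_iff₀ (by positivity), mul_pow] at h1
  have h2 : t ^ j ≤ j.factorial / r ^ j * Real.exp (r * t) := by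
    rw [div_mul_eq_mul_div, le_div_iff₀ (by positivity)]
    linarith
  have h3 : ‖Complex.exp (t * μ)‖ = Real.exp (-(r * t)) * Real.exp (-(r * t)) := by
    rw [Complex.norm_exp, ← Real.exp_add]
    congr 1
    simp [hr]
    ring
  rw [norm_mul, norm_pow, Complex.norm_real, Real.norm_of_nonneg ht, h3]
  calc t ^ j * (Real.exp (-(r * t)) * Real.exp (-(r * t)))
      ≤ j.factorial / r ^ j * Real.exp (r * t) *
        (Real.exp (-(r * t)) * Real.exp (-(r * t))) := by gcongr
    _ = j.factorial / r ^ j * Real.exp (-(r * t)) *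
        (Real.exp (r * t) * Real.exp (-(r * t))) := by ring
    _ = _ := by rw [← Real.exp_add, add_neg_cancel, Real.exp_zero, mul_one]

end ExpDecays

/-- Split A = μ + N: the two parts commute, and the series of e^{tN} stops on a vector killed by
N^k. -/
lemma exp_smul_mulVec_of_pow_eq_zero {n : ℕ} (A : Matrix (Fin n) (Fin n) ℂ) (μ : ℂ) (k : ℕ)
    (v : Fin n → ℂ) (hv : ((A - μ • 1) ^ k).mulVec v = 0) (t : ℝ) :
    (NormedSpace.exp (t • A)).mulVec v =
      ∑ j ∈ Finset.range k, ((t : ℂ) ^ j * Complex.exp (t * μ)) •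
        ((j.factorial : ℂ)⁻¹ • ((A - μ • 1) ^ j).mulVec v) := by
  set N := A - μ • 1 with hN
  have h1 : t • A = Matrix.diagonal (fun _ => (t : ℂ) * μ) + (t : ℂ) • N := by
    rw [hN, smul_sub, smul_smul, Matrix.smul_one_eq_diagonal]
    ext i j
    simp
  have hcomm : Commute (Matrix.diagonal (fun _ : Fin n => (t : ℂ) * μ)) ((t : ℂ) • N) := by
    rw [← Matrix.smul_one_eq_diagonal]
    exact (Commute.one_left _).smul_left _
  have h2 : NormedSpace.exp (Matrix.diagonal (fun _ : Fin n => (t : ℂ) * μ)) =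
      Complex.exp (t * μ) • (1 : Matrix (Fin n) (Fin n) ℂ) := by
    rw [Matrix.exp_diagonal, Matrix.smul_one_eq_diagonal, Complex.exp_eq_exp_ℂ]
    congr 1
    funext i
    rw [Pi.coe_exp]
  have h3 : (NormedSpace.exp ((t : ℂ) • N)).mulVec v =
      ∑ j ∈ Finset.range k, ((j.factorial : ℂ)⁻¹) • (((t : ℂ) • N) ^ j).mulVec v := by
    refine (hasSum_exp_mulVec _ v).unique (hasSum_sum_of_ne_finset_zero fun j hj => ?_)
    obtain ⟨i, rfl⟩ := Nat.exists_eq_add_of_le (not_lt.1 (Finset.mem_range.not.1 hj))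
    rw [smul_pow, Matrix.smul_mulVec, Nat.add_comm k i, pow_add _ i k, pow_add N, ← Matrix.mulVec_mulVec,
      hv]
    simp
  rw [h1, Matrix.exp_add_of_commute _ _ hcomm, h2, Matrix.smul_mul, one_mul, Matrix.smul_mulVec,
    h3, Finset.smul_sum]
  refine Finset.sum_congr rfl fun j _ => ?_
  rw [smul_pow, Matrix.smul_mulVec]
  simp only [smul_smul]
  congr 1
  ring

/-- Vectors with a decaying orbit form a subspace, and over ℂ the generalized eigenspaces span. It
suffices to treat each of them, which avoids the Jordan form. -/
lemma expDecays_exp_smul_mulVec {n : ℕ} (A : Matrix (Fin n) (Fin n) ℂ)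
    (hA : ∀ z ∈ spectrum ℂ A, z.re < 0) (v : Fin n → ℂ) :
    ExpDecays fun t : ℝ => (NormedSpace.exp (t • A)).mulVec v := by
  let S : Submodule ℂ (Fin n → ℂ) :=
    { carrier := {v | ExpDecays fun t : ℝ => (NormedSpace.exp (t • A)).mulVec v}
      zero_mem' := by simpa using ExpDecays.zero
      add_mem' := fun {a b} ha hb => by simpa [Matrix.mulVec_add] using ExpDecays.add ha hb
      smul_mem' := fun c v hv => ExpDecays.of_norm_le hv ‖c‖ fun t => by
        rw [Matrix.mulVec_smul, norm_smul] }
  suffices h : S = ⊤ by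
    have hv : v ∈ S := h ▸ Submodule.mem_top
    exact hv
  rw [eq_top_iff, ← Module.End.iSup_maxGenEigenspace_eq_top A.toLin']
  refine iSup_le fun μ v hv => ?_
  by_cases hμ : μ ∈ spectrum ℂ A
  · obtain ⟨k, hk⟩ := (Module.End.mem_maxGenEigenspace _ _ _).1 hv
    have hk' : ((A - μ • 1) ^ k).mulVec v = 0 := by
      rw [← Matrix.toLin'_apply, Matrix.toLin'_pow, map_sub, map_smul, Matrix.toLin'_one]
      exact hk
    change ExpDecays _
    simp only [exp_smul_mulVec_of_pow_eq_zero A μ k v hk']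
    exact ExpDecays.sum _ fun j _ => (ExpDecays.pow_mul_cexp j (hA μ hμ)).of_norm_le
      ‖((j.factorial : ℂ)⁻¹ • ((A - μ • 1) ^ j).mulVec v)‖ fun t => by rw [norm_smul, mul_comm]
  -- The supremum runs over all complex μ; outside the spectrum the generalized eigenspace is
  -- trivial.
  · have hbot : Module.End.maxGenEigenspace A.toLin' μ = ⊥ := by
      rw [← Matrix.spectrum_toLin', ← Module.End.hasEigenvalue_iff_mem_spectrum] at hμ
      by_contra hne
      have h : Module.End.HasUnifEigenvalue A.toLin' μ ⊤ := hne
      exact hμ (h.lt zero_lt_one)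
    rw [hbot, Submodule.mem_bot] at hv
    rw [hv]
    exact S.zero_mem

lemma expDecays_dotProduct_exp_mulVec {n : ℕ} (A : Matrix (Fin n) (Fin n) ℝ)
    (hA : ∀ z ∈ spectrum ℂ (A.map (algebraMap ℝ ℂ)), z.re < 0) (c v : Fin n → ℝ) :
    ExpDecays fun t : ℝ => c ⬝ᵥ (NormedSpace.exp (t • A)).mulVec v := by
  refine (expDecays_exp_smul_mulVec _ hA (fun i => (v i : ℂ))).of_norm_le (∑ i, ‖c i‖) fun t => ?_
  have h1 : NormedSpace.exp (t • A.map (algebraMap ℝ ℂ)) =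
      (NormedSpace.exp (t • A)).map (algebraMap ℝ ℂ) := by
    rw [exp_map_complex]
    congr 1
    ext i j
    simp
  have h2 : ∀ i, ‖(NormedSpace.exp (t • A)).mulVec v i‖ ≤
      ‖(NormedSpace.exp (t • A.map (algebraMap ℝ ℂ))).mulVec fun i => (v i : ℂ)‖ := by
    intro i
    refine le_trans (le_of_eq ?_) (norm_le_pi_norm _ i)
    rw [h1, ← Complex.norm_real]
    congr 1
    simp [Matrix.mulVec, dotProduct]
  rw [dotProduct, Finset.sum_mul]
  refine norm_sum_le_of_le _ fun i _ => ?_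
  rw [norm_mul]
  gcongr
  exact h2 i

/-- The impulse response `C e^{tA} B`. -/
noncomputable def CTSystem.impulse (F : CTSystem) (t : ℝ) : ℝ :=
  F.C ⬝ᵥ (NormedSpace.exp (t • F.A)).mulVec F.B

namespace CTSystem

variable (F : CTSystem)

lemma response_apply (w : ℝ → ℝ) (t : ℝ) :
    F.response w t = ∫ s in (0 : ℝ)..t, F.impulse (t - s) * w s := rfl

lemma continuous_impulse : Continuous F.impulse :=
  continuous_iff_continuousAt.2 fun t =>
    (hasDerivAt_dotProduct_exp_mulVec F.A F.C F.B t).continuousAt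

variable {F}

/-- The increment bound is the mean value inequality, the derivative C e^{tA} A B decaying as well.
Its factor d is the source of the O(τ) sampling error. -/
lemma IsStable.exists_impulse_bound (hF : F.IsStable) : ∃ r > 0, ∃ c ≥ 0,
    (∀ t, 0 ≤ t → |F.impulse t| ≤ c * Real.exp (-(r * t))) ∧
    ∀ t d, 0 ≤ t → 0 ≤ d → |F.impulse (t + d) - F.impulse t| ≤ d * (c * Real.exp (-(r * t))) := by
  obtain ⟨r, hr, c, hc, h⟩ := expDecays_dotProduct_exp_mulVec F.A hF F.C F.B
  obtain ⟨s, hs, d, hd, h'⟩ := expDecays_dotProduct_exp_mulVec F.A hF F.C (F.A.mulVec F.B)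
  refine ⟨min r s, lt_min hr hs, max c d, le_max_of_le_left hc, fun t ht => (h t ht).trans ?_,
    fun t δ ht hδ => ?_⟩
  · gcongr
    · exact le_max_left _ _
    · exact min_le_left _ _
  · have h1 : ∀ x ∈ Set.Icc t (t + δ),
        ‖F.C ⬝ᵥ (NormedSpace.exp (x • F.A)).mulVec (F.A.mulVec F.B)‖ ≤
          max c d * Real.exp (-(min r s * t)) := by
      intro x hx
      refine (h' x (ht.trans hx.1)).trans ?_
      gcongr
      · exact le_max_right _ _
      · exact min_le_right _ _
      · exact hx.1
    have h2 := (convex_Icc t (t + δ)).norm_image_sub_le_of_norm_hasDerivWithin_le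
      (fun x _ => (hasDerivAt_dotProduct_exp_mulVec F.A F.C F.B x).hasDerivWithinAt) h1
      (Set.left_mem_Icc.2 (by linarith)) (Set.right_mem_Icc.2 (by linarith))
    rw [add_sub_cancel_left, Real.norm_of_nonneg hδ, mul_comm] at h2
    exact h2

end CTSystem

/-! ### Convolution estimates on the time axis -/

lemma sq_eLpNorm_two {α : Type} [MeasurableSpace α] (μ : Measure α) (f : α → ℝ) :
    eLpNorm f 2 μ ^ 2 = ∫⁻ t, ‖f t‖ₑ ^ 2 ∂μ := by
  simpa using eLpNorm_nnreal_pow_eq_lintegral (f := f) (μ := μ) (p := 2) (by norm_num)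

lemma le_of_sq_le_sq {a b : ℝ≥0∞} (h : a ^ 2 ≤ b ^ 2) : a ≤ b :=
  le_of_not_gt fun hlt => (ENNReal.pow_lt_pow_left two_ne_zero hlt).not_ge h

section Convolution

variable {ψ : ℝ → ℝ≥0∞} {v : ℝ → ℝ≥0∞}

lemma lintegral_timeMeasure_le (f : ℝ → ℝ≥0∞) : ∫⁻ t, f t ∂timeMeasure ≤ ∫⁻ t, f t :=
  lintegral_mono' Measure.restrict_le_self le_rfl

/-- Cauchy–Schwarz after writing the kernel as ψ^{1/2} · ψ^{1/2}. -/
lemma sq_lintegral_sub_mul_le (hψ : Measurable ψ) (hv : AEMeasurable v timeMeasure) (t : ℝ) :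
    (∫⁻ s, ψ (t - s) * v s ∂timeMeasure) ^ 2 ≤
      (∫⁻ s, ψ s) * ∫⁻ s, ψ (t - s) * v s ^ 2 ∂timeMeasure := by
  have hψt : Measurable fun s => ψ (t - s) := hψ.comp (measurable_const.sub measurable_id)
  have h1 : ∀ a : ℝ≥0∞, (a ^ (1 / 2 : ℝ)) ^ (2 : ℝ) = a := fun a => by
    rw [← ENNReal.rpow_mul]; norm_num
  have h1' : ∀ a : ℝ≥0∞, a ^ (1 / 2 : ℝ) * a ^ (1 / 2 : ℝ) = a := fun a => by
    rw [← ENNReal.rpow_add_of_nonneg _ _ (by norm_num) (by norm_num)]; norm_num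
  have h2 := ENNReal.lintegral_mul_le_Lp_mul_Lq timeMeasure Real.HolderConjugate.two_two
    (f := fun s => ψ (t - s) ^ (1 / 2 : ℝ)) (g := fun s => ψ (t - s) ^ (1 / 2 : ℝ) * v s)
    (hψt.pow_const _).aemeasurable ((hψt.pow_const _).aemeasurable.mul hv)
  simp only [Pi.mul_apply, ← mul_assoc, h1'] at h2
  simp only [ENNReal.mul_rpow_of_nonneg _ _ zero_le_two, h1] at h2
  calc (∫⁻ s, ψ (t - s) * v s ∂timeMeasure) ^ 2
      ≤ ((∫⁻ s, ψ (t - s) ∂timeMeasure) ^ (1 / 2 : ℝ) *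
          (∫⁻ s, ψ (t - s) * v s ^ (2 : ℝ) ∂timeMeasure) ^ (1 / 2 : ℝ)) ^ 2 := by gcongr
    _ = (∫⁻ s, ψ (t - s) ∂timeMeasure) * ∫⁻ s, ψ (t - s) * v s ^ 2 ∂timeMeasure := by
        rw [mul_pow, sq, sq, h1', h1']
        simp
    _ ≤ (∫⁻ s, ψ (t - s)) * ∫⁻ s, ψ (t - s) * v s ^ 2 ∂timeMeasure := by
        gcongr; exact Measure.restrict_le_self
    _ = _ := by rw [lintegral_sub_left_eq_self ψ t]

/-- Young's inequality for the convolution of an `L¹` kernel with an `L²` signal. -/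
lemma lintegral_sq_lintegral_sub_mul_le (hψ : Measurable ψ) (hv : AEMeasurable v timeMeasure) :
    ∫⁻ t, (∫⁻ s, ψ (t - s) * v s ∂timeMeasure) ^ 2 ∂timeMeasure ≤
      (∫⁻ s, ψ s) ^ 2 * ∫⁻ s, v s ^ 2 ∂timeMeasure := by
  have : SFinite timeMeasure := by unfold timeMeasure; infer_instance
  have hmeas : AEMeasurable (Function.uncurry fun t s => ψ (t - s) * v s ^ 2)
      (timeMeasure.prod timeMeasure) :=
    (hψ.comp (measurable_fst.sub measurable_snd)).aemeasurable.mul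
      ((hv.comp_quasiMeasurePreserving Measure.quasiMeasurePreserving_snd).pow_const 2)
  calc ∫⁻ t, (∫⁻ s, ψ (t - s) * v s ∂timeMeasure) ^ 2 ∂timeMeasure
      ≤ ∫⁻ t, (∫⁻ s, ψ s) * ∫⁻ s, ψ (t - s) * v s ^ 2 ∂timeMeasure ∂timeMeasure :=
        lintegral_mono fun t => sq_lintegral_sub_mul_le hψ hv t
    _ = (∫⁻ s, ψ s) * ∫⁻ s, ∫⁻ t, ψ (t - s) * v s ^ 2 ∂timeMeasure ∂timeMeasure := by
        have h1 : AEMeasurable (fun t => ∫⁻ s, ψ (t - s) * v s ^ 2 ∂timeMeasure) timeMeasure :=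
          hmeas.lintegral_prod_right'
        rw [lintegral_const_mul'' _ h1, lintegral_lintegral_swap hmeas]
    _ ≤ (∫⁻ s, ψ s) * ∫⁻ s, (∫⁻ s, ψ s) * v s ^ 2 ∂timeMeasure := by
        gcongr with s
        have h1 : Measurable fun t => ψ (t - s) := hψ.comp (measurable_id.sub measurable_const)
        rw [lintegral_mul_const _ h1]
        gcongr ?_ * _
        exact (lintegral_timeMeasure_le _).trans_eq (lintegral_sub_right_eq_self ψ s)
    _ = _ := by
        rw [lintegral_const_mul'' _ (hv.pow_const 2), sq, mul_assoc]

lemma eLpNorm_le_of_convolution_bound (hψ : Measurable ψ) {w y : ℝ → ℝ}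
    (hw : AEStronglyMeasurable w timeMeasure)
    (h : ∀ t, 0 ≤ t → ‖y t‖ₑ ≤ ∫⁻ s, ψ (t - s) * ‖w s‖ₑ ∂timeMeasure) :
    eLpNorm y 2 timeMeasure ≤ (∫⁻ s, ψ s) * eLpNorm w 2 timeMeasure := by
  refine le_of_sq_le_sq ?_
  rw [mul_pow, sq_eLpNorm_two, sq_eLpNorm_two]
  refine le_trans (setLIntegral_mono_ae' measurableSet_Ici (ae_of_all _ fun t ht => ?_))
    (lintegral_sq_lintegral_sub_mul_le hψ hw.enorm)
  gcongr
  exact h t ht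

/-- Cauchy–Schwarz gives the square constant (∫ψ) · C; bounding it by (∫ψ + C)² avoids a square
root. -/
lemma enorm_le_of_convolution_bound (hψ : Measurable ψ) {C : ℝ≥0∞} (hC : ∀ x, ψ x ≤ C)
    {w : ℝ → ℝ} (hw : AEStronglyMeasurable w timeMeasure) (t : ℝ) :
    ∫⁻ s, ψ (t - s) * ‖w s‖ₑ ∂timeMeasure ≤ ((∫⁻ s, ψ s) + C) * eLpNorm w 2 timeMeasure := by
  refine le_of_sq_le_sq ((sq_lintegral_sub_mul_le hψ hw.enorm t).trans ?_)
  rw [mul_pow, sq_eLpNorm_two, sq, mul_assoc]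
  gcongr ?_ * ?_
  · exact le_self_add
  · calc ∫⁻ s, ψ (t - s) * ‖w s‖ₑ ^ 2 ∂timeMeasure
        ≤ ∫⁻ s, C * ‖w s‖ₑ ^ 2 ∂timeMeasure := by gcongr; exact hC _
      _ = C * ∫⁻ s, ‖w s‖ₑ ^ 2 ∂timeMeasure := lintegral_const_mul'' _ (hw.enorm.pow_const 2)
      _ ≤ _ := by gcongr; exact le_add_self

end Convolution

/-! ### Holds -/

section Hold

variable {τ : ℝ}

lemma hold_apply_of_mem (hτ : 0 < τ) (u : ℕ → ℝ) {k : ℕ} {t : ℝ}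
    (ht : t ∈ Set.Ico (k * τ) ((k + 1) * τ)) : hold τ u t = u k := by
  have h : ⌊t / τ⌋₊ = k := by
    have h0 : 0 ≤ t / τ := div_nonneg (le_trans (by positivity) ht.1) hτ.le
    rw [Nat.floor_eq_iff h0, le_div_iff₀ hτ, div_lt_iff₀ hτ]
    exact ht
  rw [hold, h]

lemma measurable_hold (τ : ℝ) (u : ℕ → ℝ) : Measurable (hold τ u) :=
  (measurable_from_nat (f := u)).comp (Nat.measurable_floor.comp (measurable_id.div_const τ))

lemma intervalIntegrable_hold (hτ : 0 < τ) (u : ℕ → ℝ) {a b : ℝ} (ha : 0 ≤ a) (hb : 0 ≤ b) :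
    IntervalIntegrable (hold τ u) volume a b := by
  wlog hab : a ≤ b generalizing a b
  · exact (this hb ha (le_of_not_ge hab)).symm
  rw [intervalIntegrable_iff_integrableOn_Ioc_of_le hab]
  refine Measure.integrableOn_of_bounded (M := ∑ j ∈ Finset.range (⌊b / τ⌋₊ + 1), ‖u j‖)
    (by simp) (measurable_hold τ u).aestronglyMeasurable
    ((ae_restrict_iff' measurableSet_Ioc).2 (ae_of_all _ fun t ht => ?_))
  refine Finset.single_le_sum (f := fun j => ‖u j‖) (fun _ _ => norm_nonneg _)
    (Finset.mem_range.2 (Nat.lt_succ_of_le (Nat.floor_mono ?_)))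
  gcongr
  exact ht.2

/-- The index map t ↦ ⌊t/τ⌋₊ pushes Lebesgue measure on [0, ∞) to τ times counting measure. -/
lemma eLpNorm_hold (hτ : 0 < τ) (u : ℕ → ℝ) :
    eLpNorm (hold τ u) 2 timeMeasure = ENNReal.ofReal τ ^ (1 / 2 : ℝ) * l2Norm u := by
  have hfl : Measurable fun t : ℝ => ⌊t / τ⌋₊ :=
    Nat.measurable_floor.comp (measurable_id.div_const τ)
  have h1 : ∀ k : ℕ, (timeMeasure.map fun t : ℝ => ⌊t / τ⌋₊) {k} = ENNReal.ofReal τ := by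
    intro k
    have : (fun t : ℝ => ⌊t / τ⌋₊) ⁻¹' {k} ∩ Set.Ici 0 = Set.Ico (k * τ) ((k + 1) * τ) := by
      ext t
      simp only [Set.mem_inter_iff, Set.mem_preimage, Set.mem_singleton_iff, Set.mem_Ici,
        Set.mem_Ico]
      constructor
      · rintro ⟨h, h0⟩
        rwa [Nat.floor_eq_iff (div_nonneg h0 hτ.le), le_div_iff₀ hτ, div_lt_iff₀ hτ] at h
      · intro h
        have h0 : 0 ≤ t := le_trans (by positivity) h.1
        refine ⟨?_, h0⟩
        rwa [Nat.floor_eq_iff (div_nonneg h0 hτ.le), le_div_iff₀ hτ, div_lt_iff₀ hτ]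
    rw [Measure.map_apply hfl (measurableSet_singleton k), timeMeasure,
      Measure.restrict_apply (hfl (measurableSet_singleton k)), this, Real.volume_Ico]
    congr 1
    ring
  have h2 : eLpNorm (hold τ u) 2 timeMeasure ^ 2 = ENNReal.ofReal τ * ∑' k, ‖u k‖ₑ ^ 2 := by
    rw [sq_eLpNorm_two]
    have h3 := lintegral_map (μ := timeMeasure)
      (measurable_from_nat (f := fun k : ℕ => ‖u k‖ₑ ^ 2)) hfl
    rw [lintegral_countable'] at h3
    simp only [h1, ENNReal.tsum_mul_right] at h3
    rw [mul_comm, h3]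
    rfl
  rw [l2Norm_real, ← ENNReal.mul_rpow_of_nonneg _ _ (by norm_num), ← h2, ← ENNReal.rpow_natCast,
    ← ENNReal.rpow_mul]
  norm_num

end Hold

/-! ### The response of a stable system -/

/-- The kernel `e^{-rx}` on `x ≥ 0`. -/
noncomputable def expKernel (r : ℝ) : ℝ → ℝ≥0∞ :=
  (Set.Ici 0).indicator fun x => ENNReal.ofReal (Real.exp (-(r * x)))

section Kernel

variable {r : ℝ}

lemma measurable_expKernel (r : ℝ) : Measurable (expKernel r) :=
  (by fun_prop : Measurable fun x => ENNReal.ofReal (Real.exp (-(r * x)))).indicator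
    measurableSet_Ici

lemma expKernel_of_nonneg {x : ℝ} (hx : 0 ≤ x) :
    expKernel r x = ENNReal.ofReal (Real.exp (-(r * x))) :=
  Set.indicator_of_mem (Set.mem_Ici.2 hx) _

lemma expKernel_le_one (hr : 0 < r) (x : ℝ) : expKernel r x ≤ 1 := by
  refine Set.indicator_le' (s := Set.Ici (0 : ℝ)) (g := fun _ => (1 : ℝ≥0∞)) (fun x hx => ?_)
    (fun _ _ => zero_le) x
  rw [ENNReal.ofReal_le_one, Real.exp_le_one_iff]
  have : 0 ≤ r * x := mul_nonneg hr.le hx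
  linarith

lemma lintegral_expKernel_ne_top (hr : 0 < r) : ∫⁻ x, expKernel r x ≠ ∞ := by
  unfold expKernel
  rw [lintegral_indicator measurableSet_Ici, setLIntegral_congr Ioi_ae_eq_Ici.symm]
  have h := (exp_neg_integrableOn_Ioi 0 hr).lintegral_lt_top
  simpa [neg_mul] using h.ne

end Kernel

section LocalIntegrability

variable {w : ℝ → ℝ}

lemma intervalIntegrable_of_memLp (hw : MemLp w 2 timeMeasure) {a b : ℝ} (ha : 0 ≤ a)
    (hb : 0 ≤ b) : IntervalIntegrable w volume a b := by
  wlog hab : a ≤ b generalizing a b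
  · exact (this hb ha (le_of_not_ge hab)).symm
  rw [intervalIntegrable_iff_integrableOn_Ioc_of_le hab]
  have h1 : MemLp w 2 (volume.restrict (Set.Ioc a b)) :=
    hw.mono_measure (Measure.restrict_mono (fun x hx => ha.trans hx.1.le) le_rfl)
  exact h1.integrable (by norm_num)

lemma enorm_intervalIntegral_le {t : ℝ} (ht : 0 ≤ t) (f : ℝ → ℝ) {ψ : ℝ → ℝ≥0∞}
    (h : ∀ s ∈ Set.Ioc 0 t, ‖f s‖ₑ ≤ ψ s) :
    ‖∫ s in (0 : ℝ)..t, f s‖ₑ ≤ ∫⁻ s, ψ s ∂timeMeasure := by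
  rw [intervalIntegral.integral_of_le ht]
  refine (enorm_integral_le_lintegral_enorm _).trans ?_
  refine (setLIntegral_mono_ae' measurableSet_Ioc (ae_of_all _ h)).trans ?_
  exact lintegral_mono' (Measure.restrict_mono (fun x hx => hx.1.le) le_rfl) le_rfl

end LocalIntegrability

/-! ### Boundedness, sampling error and discretization of the response -/

namespace CTSystem

variable {F : CTSystem}

lemma intervalIntegrable_impulse_mul (F : CTSystem) {w : ℝ → ℝ} {a b : ℝ}
    (hw : IntervalIntegrable w volume a b) (t : ℝ) :
    IntervalIntegrable (fun s => F.impulse (t - s) * w s) volume a b :=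
  hw.continuousOn_mul (F.continuous_impulse.comp (continuous_const.sub continuous_id)).continuousOn

lemma response_sub (F : CTSystem) {v w : ℝ → ℝ} (hv : MemLp v 2 timeMeasure)
    (hw : MemLp w 2 timeMeasure) {t : ℝ} (ht : 0 ≤ t) :
    F.response (v - w) t = F.response v t - F.response w t := by
  simp only [response_apply, Pi.sub_apply, mul_sub]
  exact intervalIntegral.integral_sub
    (F.intervalIntegrable_impulse_mul (intervalIntegrable_of_memLp hv le_rfl ht) t)
    (F.intervalIntegrable_impulse_mul (intervalIntegrable_of_memLp hw le_rfl ht) t)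

/-- The response is a parametric integral of a function on the triangle s ≤ t, measurable by the
Fubini theory. -/
lemma aestronglyMeasurable_response (F : CTSystem) {w : ℝ → ℝ}
    (hw : AEStronglyMeasurable w timeMeasure) :
    AEStronglyMeasurable (F.response w) timeMeasure := by
  have : SFinite timeMeasure := by unfold timeMeasure; infer_instance
  have h1 : AEStronglyMeasurable ({p : ℝ × ℝ | p.2 ≤ p.1}.indicator
      fun p => F.impulse (p.1 - p.2) * w p.2) (timeMeasure.prod timeMeasure) :=
    ((F.continuous_impulse.comp (continuous_fst.sub continuous_snd)).aestronglyMeasurable.mul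
      (hw.comp_quasiMeasurePreserving Measure.quasiMeasurePreserving_snd)).indicator
      (measurableSet_le measurable_snd measurable_fst)
  refine h1.integral_prod_right'.congr ?_
  refine (ae_restrict_iff' measurableSet_Ici).2 (ae_of_all _ fun t ht => ?_)
  have h2 : (fun s => {p : ℝ × ℝ | p.2 ≤ p.1}.indicator
      (fun p => F.impulse (p.1 - p.2) * w p.2) (t, s)) =
      (Set.Iic t).indicator fun s => F.impulse (t - s) * w s := by
    funext s
    simp [Set.indicator_apply]
  beta_reduce
  rw [h2, integral_indicator measurableSet_Iic, timeMeasure,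
    Measure.restrict_restrict measurableSet_Iic, Set.inter_comm, Set.Ici_inter_Iic,
    integral_Icc_eq_integral_Ioc, response_apply, intervalIntegral.integral_of_le ht]

/-- The pointwise bound is needed besides Young's inequality: it makes each sample of the response
continuous in the L² input. -/
lemma IsStable.exists_response_bound (hF : F.IsStable) : ∃ c : ℝ≥0∞, c ≠ ∞ ∧
    ∀ w, AEStronglyMeasurable w timeMeasure →
      eLpNorm (F.response w) 2 timeMeasure ≤ c * eLpNorm w 2 timeMeasure ∧
      ∀ t, 0 ≤ t → ‖F.response w t‖ₑ ≤ c * eLpNorm w 2 timeMeasure := by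
  obtain ⟨r, hr, c, hc, hg, -⟩ := hF.exists_impulse_bound
  set ψ : ℝ → ℝ≥0∞ := fun x => ENNReal.ofReal c * expKernel r x with hψ
  have hψm : Measurable ψ := (measurable_expKernel r).const_mul _
  have hψi : ∫⁻ x, ψ x ≠ ∞ := by
    rw [hψ, lintegral_const_mul _ (measurable_expKernel r)]
    exact ENNReal.mul_ne_top ENNReal.ofReal_ne_top (lintegral_expKernel_ne_top hr)
  have hψb : ∀ x, ψ x ≤ ENNReal.ofReal c := fun x =>
    mul_le_of_le_one_right' (expKernel_le_one hr x)
  have hy : ∀ (w : ℝ → ℝ) (t : ℝ), 0 ≤ t →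
      ‖F.response w t‖ₑ ≤ ∫⁻ s, ψ (t - s) * ‖w s‖ₑ ∂timeMeasure := by
    intro w t ht
    refine enorm_intervalIntegral_le ht _ fun s hs => ?_
    rw [enorm_mul]
    gcongr
    have hts : 0 ≤ t - s := sub_nonneg.2 hs.2
    simp only [hψ]
    rw [expKernel_of_nonneg hts, ← ENNReal.ofReal_mul hc, ← ofReal_norm]
    exact ENNReal.ofReal_le_ofReal (hg _ hts)
  refine ⟨(∫⁻ x, ψ x) + ENNReal.ofReal c, ENNReal.add_ne_top.2 ⟨hψi, ENNReal.ofReal_ne_top⟩,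
    fun w hw => ⟨?_, fun t ht => (hy w t ht).trans (enorm_le_of_convolution_bound hψm hψb hw t)⟩⟩
  refine (eLpNorm_le_of_convolution_bound hψm hw (hy w)).trans ?_
  gcongr
  exact le_self_add

lemma response_sub_response (F : CTSystem) {w : ℝ → ℝ} (hw : MemLp w 2 timeMeasure) {a t : ℝ}
    (ha : 0 ≤ a) (hat : a ≤ t) :
    F.response w t - F.response w a = ∫ s in (0 : ℝ)..t,
      (F.impulse (t - s) - if s ≤ a then F.impulse (a - s) else 0) * w s := by
  have ht := ha.trans hat
  have i1 := F.intervalIntegrable_impulse_mul (intervalIntegrable_of_memLp hw le_rfl ht) t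
  have i2 : IntervalIntegrable (fun s => (if s ≤ a then F.impulse (a - s) else 0) * w s)
      volume 0 t := by
    have h := F.intervalIntegrable_impulse_mul (intervalIntegrable_of_memLp hw le_rfl ht) a
    rw [intervalIntegrable_iff] at h ⊢
    refine (h.indicator (measurableSet_Iic (a := a))).congr (ae_of_all _ fun s => ?_)
    simp [Set.indicator_apply]
  have h3 : ∫ s in (0 : ℝ)..t, (if s ≤ a then F.impulse (a - s) else 0) * w s =
      F.response w a := by
    have h4 : (fun s => (if s ≤ a then F.impulse (a - s) else 0) * w s) =
        (Set.Iic a).indicator fun s => F.impulse (a - s) * w s := by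
      funext s
      simp [Set.indicator_apply]
    rw [response_apply, intervalIntegral.integral_of_le ht, intervalIntegral.integral_of_le ha, h4,
      setIntegral_indicator measurableSet_Iic, Set.Ioc_inter_Iic, min_eq_right hat]
  simp only [sub_mul]
  rw [intervalIntegral.integral_sub i1 i2, h3, response_apply]

/-- Let a be the last sampling instant before t. Inputs at s ≤ a act through an increment of the
impulse response over a time at most τ; inputs at s > a act through a bounded kernel supported on a
window of length τ. Both kernels have integral O(τ), and Young's inequality applies. -/
lemma IsStable.exists_response_sub_hold_bound (hF : F.IsStable) (h : ℝ) :
    ∃ c : ℝ≥0∞, c ≠ ∞ ∧ ∀ τ, 0 < τ → τ ≤ h → ∀ w, MemLp w 2 timeMeasure →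
      eLpNorm (F.response w - hold τ (sampler τ (F.response w))) 2 timeMeasure ≤
        ENNReal.ofReal τ * c * eLpNorm w 2 timeMeasure := by
  obtain ⟨r, hr, c, hc, hg, hg'⟩ := hF.exists_impulse_bound
  refine ⟨ENNReal.ofReal (c * Real.exp (r * h)) * (∫⁻ x, expKernel r x) + ENNReal.ofReal c,
    ENNReal.add_ne_top.2 ⟨ENNReal.mul_ne_top ENNReal.ofReal_ne_top (lintegral_expKernel_ne_top hr),
      ENNReal.ofReal_ne_top⟩, fun τ hτ hτh w hw => ?_⟩
  -- The increment bound involves e^{-r(a-s)}; since t − a ≤ τ ≤ h, the factor e^{rh} turns it into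
  -- a function of t − s.
  set ψ : ℝ → ℝ≥0∞ := fun x =>
    ENNReal.ofReal τ * ENNReal.ofReal (c * Real.exp (r * h)) * expKernel r x +
      (Set.Icc 0 τ).indicator (fun _ => ENNReal.ofReal c) x with hψ
  have hψm : Measurable ψ := ((measurable_expKernel r).const_mul _).add
    (measurable_const.indicator measurableSet_Icc)
  have hψi : ∫⁻ x, ψ x = ENNReal.ofReal τ *
      (ENNReal.ofReal (c * Real.exp (r * h)) * (∫⁻ x, expKernel r x) + ENNReal.ofReal c) := by
    rw [hψ, lintegral_add_left ((measurable_expKernel r).const_mul _),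
      lintegral_const_mul _ (measurable_expKernel r), lintegral_indicator measurableSet_Icc,
      setLIntegral_const, Real.volume_Icc, sub_zero, mul_add, mul_assoc,
      mul_comm (ENNReal.ofReal c) (ENNReal.ofReal τ)]
  rw [← hψi]
  refine eLpNorm_le_of_convolution_bound hψm hw.1 fun t ht => ?_
  have hfl : (⌊t / τ⌋₊ : ℝ) * τ ≤ t := by
    rw [← le_div_iff₀ hτ]
    exact Nat.floor_le (div_nonneg ht hτ.le)
  have hfl' : t < ((⌊t / τ⌋₊ : ℝ) + 1) * τ := by
    rw [← div_lt_iff₀ hτ]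
    exact Nat.lt_floor_add_one _
  set a : ℝ := (⌊t / τ⌋₊ : ℝ) * τ with ha
  have ha0 : 0 ≤ a := by positivity
  have hy : (F.response w - hold τ (sampler τ (F.response w))) t =
      F.response w t - F.response w a := rfl
  rw [hy, F.response_sub_response hw ha0 hfl]
  refine enorm_intervalIntegral_le ht _ fun s hs => ?_
  rw [enorm_mul]
  gcongr
  have hts : 0 ≤ t - s := sub_nonneg.2 hs.2
  split_ifs with hsa
  · refine le_add_right ?_
    rw [expKernel_of_nonneg hts, ← ENNReal.ofReal_mul hτ.le, ← ENNReal.ofReal_mul (by positivity),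
      ← ofReal_norm]
    refine ENNReal.ofReal_le_ofReal ?_
    have h1 := hg' (a - s) (t - a) (by linarith) (by linarith)
    rw [show a - s + (t - a) = t - s by ring] at h1
    refine h1.trans ?_
    rw [mul_assoc, mul_assoc, ← Real.exp_add]
    gcongr
    · linarith
    · nlinarith
  · refine le_add_left ?_
    rw [Set.indicator_of_mem (by constructor <;> linarith), ← ofReal_norm, sub_zero]
    refine ENNReal.ofReal_le_ofReal ((hg _ hts).trans ?_)
    refine mul_le_of_le_one_right hc (Real.exp_le_one_iff.2 ?_)
    have : 0 ≤ r * (t - s) := mul_nonneg hr.le hts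
    linarith

/-- The step-invariant discretization of a finite-dimensional system is finite-dimensional. -/
lemma isFiniteDimensional_ctd (F : CTSystem) {τ : ℝ} (hτ : 0 < τ) :
    IsFiniteDimensional (ctd τ F.response) := by
  let g : (Fin F.dim → ℝ) → ℝ → ℝ := fun c t => c ⬝ᵥ (NormedSpace.exp (t • F.A)).mulVec F.B
  have hgc : ∀ c, Continuous (g c) := fun c =>
    continuous_iff_continuousAt.2 fun t =>
      (hasDerivAt_dotProduct_exp_mulVec F.A c F.B t).continuousAt
  let b : Fin F.dim → ℝ := fun i => ∫ t in (0 : ℝ)..τ, g (Pi.single i 1) t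
  have hb : ∀ c, c ⬝ᵥ b = ∫ t in (0 : ℝ)..τ, g c t := by
    intro c
    simp only [dotProduct, b, ← intervalIntegral.integral_const_mul]
    rw [← intervalIntegral.integral_finsetSum fun i _ =>
      ((hgc (Pi.single i 1)).const_mul (c i)).intervalIntegrable _ _]
    congr 1
    funext t
    simp only [g, single_one_dotProduct]
    rfl
  let G : StateSpace ℝ ℝ :=
    ⟨F.dim, (NormedSpace.exp (τ • F.A)).mulVecLin, LinearMap.toSpanSingleton ℝ _ b,
      { toFun := fun x => F.C ⬝ᵥ x
        map_add' := dotProduct_add F.C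
        map_smul' := fun r x => dotProduct_smul r F.C x }, 0⟩
  have hshift : ∀ c t, g (Matrix.vecMul c (NormedSpace.exp (τ • F.A))) t = g c (τ + t) := by
    intro c t
    simp only [g]
    rw [← Matrix.dotProduct_mulVec, Matrix.mulVec_mulVec, add_smul, Matrix.exp_add_of_commute]
    exact ((Commute.refl F.A).smul_left τ).smul_right t
  -- The identity is proved for all c because the induction moves e^{τA} from the state onto c. The
  -- last sampling period is split off; there the hold is constant and contributes the input vector
  -- `b`.
  have key : ∀ u k c, c ⬝ᵥ G.state u k =
      ∫ s in (0 : ℝ)..(k * τ), g c (k * τ - s) * hold τ u s := by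
    intro u k
    induction k with
    | zero => intro c; simp [StateSpace.state]
    | succ k ih =>
      intro c
      have h0 : (0 : ℝ) ≤ k * τ := by positivity
      have h1 : (0 : ℝ) ≤ (k + 1 : ℕ) * τ := by positivity
      have hi : ∀ {a e : ℝ}, 0 ≤ a → 0 ≤ e → IntervalIntegrable
          (fun s => g c ((k + 1 : ℕ) * τ - s) * hold τ u s) volume a e := fun ha he =>
        (intervalIntegrable_hold hτ u ha he).continuousOn_mul
          ((hgc c).comp (continuous_const.sub continuous_id)).continuousOn
      rw [← intervalIntegral.integral_add_adjacent_intervals (hi le_rfl h0) (hi h0 h1)]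
      change c ⬝ᵥ ((NormedSpace.exp (τ • F.A)).mulVec (G.state u k) + u k • b) = _
      rw [dotProduct_add, Matrix.dotProduct_mulVec, ih, dotProduct_smul, hb]
      congr 1
      · congr 1
        funext s
        rw [hshift]
        congr 2
        push_cast
        ring
      · have h2 : ∀ s ∈ Set.Ioo (k * τ) ((k + 1 : ℕ) * τ),
            g c ((k + 1 : ℕ) * τ - s) * hold τ u s = g c ((k + 1 : ℕ) * τ - s) * u k := by
          intro s hs
          rw [hold_apply_of_mem hτ u ⟨hs.1.le, by exact_mod_cast hs.2⟩]
        have h3 : (k : ℝ) * τ ≤ (k + 1 : ℕ) * τ := by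
          gcongr; exact k.le_succ
        rw [intervalIntegral.integral_of_le h3, integral_Ioc_eq_integral_Ioo,
          setIntegral_congr_fun measurableSet_Ioo h2, ← integral_Ioc_eq_integral_Ioo,
          ← intervalIntegral.integral_of_le h3, intervalIntegral.integral_mul_const,
          intervalIntegral.integral_comp_sub_left (g c), smul_eq_mul, mul_comm]
        congr 2
        · simp
        · push_cast; ring
  refine ⟨G, fun u => ?_⟩
  funext k
  rw [StateSpace.output]
  change F.response (hold τ u) (k * τ) = F.C ⬝ᵥ G.state u k + (0 : ℝ →ₗ[ℝ] ℝ) (u k)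
  rw [key, LinearMap.zero_apply, add_zero]
  rfl

end CTSystem

/-! ### The delay of continuous-time signals -/

section Delay

/-- The delay is a translation of the signal extended by zero, so translation invariance of Lebesgue
measure applies. -/
lemma ctDelay_eq (L : ℝ) (y : ℝ → ℝ) :
    ctDelay L y = fun t => (Set.Ici 0).indicator y (t - L) := by
  funext t
  by_cases h : t < L
  · rw [ctDelay, if_pos h, Set.indicator_of_notMem (by simpa using h)]
  · rw [ctDelay, if_neg h, Set.indicator_of_mem (by simpa using h)]

lemma aestronglyMeasurable_ctDelay (L : ℝ) {y : ℝ → ℝ}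
    (hy : AEStronglyMeasurable y timeMeasure) :
    AEStronglyMeasurable (ctDelay L y) timeMeasure := by
  rw [ctDelay_eq]
  have h1 : AEStronglyMeasurable ((Set.Ici 0).indicator y) volume :=
    (aestronglyMeasurable_indicator_iff measurableSet_Ici).2 hy
  exact (h1.comp_measurePreserving (measurePreserving_sub_right volume L)).mono_measure
    Measure.restrict_le_self

lemma eLpNorm_ctDelay_le (L : ℝ) {y : ℝ → ℝ} (hy : AEStronglyMeasurable y timeMeasure) :
    eLpNorm (ctDelay L y) 2 timeMeasure ≤ eLpNorm y 2 timeMeasure := by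
  rw [ctDelay_eq]
  have h1 : AEStronglyMeasurable ((Set.Ici 0).indicator y) volume :=
    (aestronglyMeasurable_indicator_iff measurableSet_Ici).2 hy
  have h2 := eLpNorm_comp_measurePreserving (p := 2) h1 (measurePreserving_sub_right volume L)
  rw [eLpNorm_indicator_eq_eLpNorm_restrict measurableSet_Ici] at h2
  exact (eLpNorm_mono_measure _ Measure.restrict_le_self).trans_eq h2

end Delay

/-! ### The fast discretization of the error system -/

section ErrorSystem

variable {F : CTSystem} {h L : ℝ} {m M : ℕ} [NeZero M] {b : Fin M → Bool}
  {K : (ℕ → (Fin (numOnes b) → ℝ)) → (ℕ → (Fin M → ℝ))}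

/-- Three facts about the fast grid: every n-th fast sample is a slow sample, the slow hold is
constant over a block of n fast instants, and L is exactly mn fast periods. -/
lemma fastSystem_eq (F : CTSystem) (hh : 0 < h) (hL : L = m * h)
    (K : (ℕ → (Fin (numOnes b) → ℝ)) → (ℕ → (Fin M → ℝ))) (n : ℕ) [NeZero n] :
    fastSystem F h m b K n = lift M (lift n (ctd (h / n) (errorSystem F h L b K))) := by
  have hn : (0 : ℝ) < n := by exact_mod_cast Nat.pos_of_neZero n
  have hτ : 0 < h / n := by positivity
  have hnτ : (n : ℝ) * (h / n) = h := by field_simp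
  funext u k i j
  set y := F.response (hold (h / n) (idlift n (idlift M u))) with hy
  have h3 : lift M (G3 F h n) u = dlift M (sampler h y) := by
    funext k i
    change y (((k * M + (i : ℕ)) * n + (0 : Fin n) : ℕ) * (h / n)) = y ((k * M + (i : ℕ) : ℕ) * h)
    congr 1
    push_cast [Fin.val_zero]
    rw [add_zero, mul_assoc, hnτ]
  set x := K (select b (dlift M (sampler h y))) with hx
  set q : ℕ := k * M + i with hq
  have hN : ((q * n + j : ℕ) : ℝ) * (h / n) = q * h + j * (h / n) := by
    push_cast
    rw [add_mul, mul_assoc, hnτ]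
  have hj : (j : ℝ) * (h / n) < h := by
    conv_rhs => rw [← hnτ]
    gcongr
    exact_mod_cast j.isLt
  have hLτ : L = (m * n : ℕ) * (h / n) := by
    push_cast
    rw [hL, mul_assoc, hnτ]
  have h1 : delay (m * n) (ctd (h / n) F.response (idlift n (idlift M u))) (q * n + j) =
      ctDelay L y ((q * n + j : ℕ) * (h / n)) := by
    have hlt : q * n + (j : ℕ) < m * n ↔ ((q * n + j : ℕ) : ℝ) * (h / n) < L := by
      rw [hLτ, mul_lt_mul_iff_left₀ hτ, Nat.cast_lt]
    simp only [delay, ctDelay, hlt]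
    split_ifs with hc
    · rfl
    · change y (((q * n + j - m * n : ℕ) : ℝ) * (h / n)) = _
      rw [Nat.cast_sub (not_lt.1 (hlt.not.2 hc)), sub_mul, hLτ]
  have h2 : idlift M x q = hold h (idlift M x) ((q * n + j : ℕ) * (h / n)) := by
    rw [hold_apply_of_mem hh (idlift M x) (k := q)]
    rw [hN]
    constructor
    · have : 0 ≤ (j : ℝ) * (h / n) := by positivity
      linarith
    · linarith
  change delay (m * n) (ctd (h / n) F.response (idlift n (idlift M u))) (q * n + j) -
    idlift M (K (select b (lift M (G3 F h n) u))) q = ctDelay L y ((q * n + j : ℕ) * (h / n)) -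
    hold h (idlift M x) ((q * n + j : ℕ) * (h / n))
  rw [h3, h1, h2]

lemma isFiniteDimensional_lift_G1 (F : CTSystem) (hh : 0 < h) (m n M : ℕ) [NeZero n] [NeZero M] :
    IsFiniteDimensional (lift M (G1 F h m n)) := by
  have hτ : 0 < h / n := div_pos hh (by exact_mod_cast Nat.pos_of_neZero n)
  exact (((IsFiniteDimensional.delay (m * n)).comp (F.isFiniteDimensional_ctd hτ)).lift n).lift M

lemma isFiniteDimensional_lift_G2 (n M : ℕ) [NeZero M] :
    IsFiniteDimensional (lift M (G2 n)) :=
  (IsFiniteDimensional.memoryless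
    (LinearMap.pi fun _ : Fin n => (LinearMap.id : ℝ →ₗ[ℝ] ℝ))).lift M

lemma isFiniteDimensional_lift_G3 (F : CTSystem) (hh : 0 < h) (n M : ℕ) [NeZero n] [NeZero M] :
    IsFiniteDimensional (lift M (G3 F h n)) := by
  have hτ : 0 < h / n := div_pos hh (by exact_mod_cast Nat.pos_of_neZero n)
  exact ((IsFiniteDimensional.memoryless (LinearMap.proj (R := ℝ) (φ := fun _ : Fin n => ℝ) 0)).comp
    ((F.isFiniteDimensional_ctd hτ).lift n)).lift M

lemma isFiniteDimensional_select {M : ℕ} (b : Fin M → Bool) : IsFiniteDimensional (select b) :=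
  IsFiniteDimensional.memoryless (selection b).mulVecLin

lemma isLTI_fastSystem (F : CTSystem) (hh : 0 < h) (m : ℕ) (hK : IsLTI K) (n : ℕ) [NeZero n] :
    IsLTI (fastSystem F h m b K n) :=
  (isFiniteDimensional_lift_G1 F hh m n M).isLTI.sub
    ((isFiniteDimensional_lift_G2 n M).isLTI.comp (hK.comp ((isFiniteDimensional_select b).isLTI.comp
      (isFiniteDimensional_lift_G3 F hh n M).isLTI)))

lemma isFiniteDimensional_fastSystem (F : CTSystem) (hh : 0 < h) (m : ℕ)
    (hK : IsFiniteDimensional K) (n : ℕ) [NeZero n] :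
    IsFiniteDimensional (fastSystem F h m b K n) :=
  (isFiniteDimensional_lift_G1 F hh m n M).sub
    ((isFiniteDimensional_lift_G2 n M).comp (hK.comp ((isFiniteDimensional_select b).comp
      (isFiniteDimensional_lift_G3 F hh n M))))

/-- The fast sample-and-hold acts on the error system only through the response of `F`: the
reconstructed signal is constant on the intervals of length `h`. -/
lemma errorSystem_sub_hold_sampler (F : CTSystem) (hh : 0 < h) (hL : L = m * h)
    (K : (ℕ → (Fin (numOnes b) → ℝ)) → (ℕ → (Fin M → ℝ))) (n : ℕ) [NeZero n] (w : ℝ → ℝ) {t : ℝ}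
    (ht : 0 ≤ t) :
    errorSystem F h L b K w t - hold (h / n) (sampler (h / n) (errorSystem F h L b K w)) t =
      ctDelay L (F.response w - hold (h / n) (sampler (h / n) (F.response w))) t := by
  have hn : (0 : ℝ) < n := by exact_mod_cast Nat.pos_of_neZero n
  have hτ : 0 < h / n := by positivity
  have hnτ : (n : ℝ) * (h / n) = h := by field_simp
  set τ := h / n with hτdef
  set y := F.response w
  set x := idlift M (K (select b (dlift M (sampler h y))))
  set k := ⌊t / τ⌋₊ with hk
  -- The fast grid refines the slow one: ⌊⌊t/τ⌋/n⌋ = ⌊t/h⌋.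
  have h1 : hold h x (k * τ) = hold h x t := by
    have e1 : (k : ℝ) * τ / h = (k : ℝ) / n := by
      rw [hτdef]; field_simp
    have e2 : t / h = t / τ / n := by
      rw [hτdef]; field_simp
    rw [hold, hold, e1, e2, Nat.floor_div_natCast, Nat.floor_div_natCast, Nat.floor_natCast]
  have hLτ : L = (m * n : ℕ) * τ := by
    rw [hL, ← hnτ]; push_cast; ring
  -- As L lies on the fast grid, t and its last fast instant are on the same side of L.
  have h2 : (k : ℝ) * τ < L ↔ t < L := by
    rw [hLτ, mul_lt_mul_iff_left₀ hτ, Nat.cast_lt, hk, Nat.floor_lt (div_nonneg ht hτ.le),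
      div_lt_iff₀ hτ]
  have h3 : ctDelay L y t - ctDelay L y (k * τ) = ctDelay L (y - hold τ (sampler τ y)) t := by
    simp only [ctDelay, h2]
    split_ifs with hc
    · simp
    · have e : ((⌊(t - L) / τ⌋₊ : ℕ) : ℝ) * τ = k * τ - L := by
        have e1 : (t - L) / τ = t / τ - (m * n : ℕ) := by
          rw [hLτ]; field_simp
        have e2 : m * n ≤ k := by
          have := h2.not.2 hc
          rw [hLτ, mul_lt_mul_iff_left₀ hτ, Nat.cast_lt] at this
          omega
        rw [e1, Nat.floor_sub_natCast, Nat.cast_sub e2, sub_mul, hLτ]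
      change y (t - L) - y (k * τ - L) = y (t - L) - y ((⌊(t - L) / τ⌋₊ : ℕ) * τ)
      rw [e]
  change ctDelay L y t - hold h x t - (ctDelay L y (k * τ) - hold h x (k * τ)) = _
  rw [h1, ← h3]
  ring

lemma aestronglyMeasurable_errorSystem (F : CTSystem) (h L : ℝ)
    (K : (ℕ → (Fin (numOnes b) → ℝ)) → (ℕ → (Fin M → ℝ))) {w : ℝ → ℝ}
    (hw : AEStronglyMeasurable w timeMeasure) :
    AEStronglyMeasurable (errorSystem F h L b K w) timeMeasure :=
  (aestronglyMeasurable_ctDelay L (F.aestronglyMeasurable_response hw)).sub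
    (measurable_hold _ _).aestronglyMeasurable

lemma exists_errorSystem_sub_hold_bound (hF : F.IsStable) (hh : 0 < h) (hL : L = m * h)
    (K : (ℕ → (Fin (numOnes b) → ℝ)) → (ℕ → (Fin M → ℝ))) :
    ∃ c : ℝ≥0∞, c ≠ ∞ ∧ ∀ (n : ℕ) [NeZero n] (w : ℝ → ℝ), MemLp w 2 timeMeasure →
      eLpNorm (errorSystem F h L b K w -
        hold (h / n) (sampler (h / n) (errorSystem F h L b K w))) 2 timeMeasure ≤
      ENNReal.ofReal (h / n) * c * eLpNorm w 2 timeMeasure := by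
  obtain ⟨c, hc, hb⟩ := hF.exists_response_sub_hold_bound h
  refine ⟨c, hc, fun n _ w hw => ?_⟩
  have hn : (1 : ℝ) ≤ n := by exact_mod_cast Nat.pos_of_neZero n
  have hmeas := (F.aestronglyMeasurable_response hw.1).sub
    (measurable_hold (h / n) (sampler (h / n) (F.response w))).aestronglyMeasurable
  refine le_trans (le_of_eq (eLpNorm_congr_ae ?_))
    ((eLpNorm_ctDelay_le L hmeas).trans (hb (h / n) (by positivity) (div_le_self hh.le hn) w hw))
  exact (ae_restrict_iff' measurableSet_Ici).2 (ae_of_all _ fun t ht =>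
    errorSystem_sub_hold_sampler F hh hL K n w ht)

/-- Only finitely many samples of the response influence the reconstruction at a given time, so
pointwise continuity holds even for an unbounded filter. -/
lemma tendsto_errorSystem (hF : F.IsStable) (hh : 0 ≤ h) (hK : IsLTI K) {w : ℕ → ℝ → ℝ}
    {v : ℝ → ℝ} (hw : ∀ i, MemLp (w i) 2 timeMeasure) (hv : MemLp v 2 timeMeasure)
    (hlim : Tendsto (fun i => eLpNorm (w i - v) 2 timeMeasure) atTop (𝓝 0)) (t : ℝ) :
    Tendsto (fun i => errorSystem F h L b K (w i) t) atTop
      (𝓝 (errorSystem F h L b K v t)) := by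
  obtain ⟨c, hc, hb⟩ := hF.exists_response_bound
  have hy : ∀ t, 0 ≤ t → Tendsto (fun i => F.response (w i) t) atTop (𝓝 (F.response v t)) := by
    intro t ht
    rw [tendsto_iff_edist_tendsto_0]
    have h0 : Tendsto (fun i => c * eLpNorm (w i - v) 2 timeMeasure) atTop (𝓝 0) := by
      simpa using ENNReal.Tendsto.const_mul hlim (Or.inr hc)
    refine tendsto_of_tendsto_of_tendsto_of_le_of_le tendsto_const_nhds h0 (fun _ => zero_le)
      fun i => ?_
    rw [edist_eq_enorm_sub, ← F.response_sub (hw i) hv ht]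
    exact (hb _ ((hw i).sub hv).1).2 t ht
  refine Tendsto.sub ?_ ?_
  · simp only [ctDelay]
    split_ifs with hc
    · exact tendsto_const_nhds
    · exact hy _ (by linarith)
  · simp only [hold, idlift]
    refine tendsto_pi_nhds.1 (hK.tendsto (fun j => tendsto_pi_nhds.2 fun r => ?_) _) _
    simp only [select, selection_mulVec, dlift, sampler]
    exact hy _ (by positivity)

/-- Boundedness of the error system passes to `L²` limits of the inputs. -/
lemma eLpNorm_errorSystem_le_of_tendsto (hF : F.IsStable) (hh : 0 ≤ h) (hK : IsLTI K)
    {w : ℕ → ℝ → ℝ} {v : ℝ → ℝ} (hw : ∀ i, MemLp (w i) 2 timeMeasure)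
    (hv : MemLp v 2 timeMeasure)
    (hlim : Tendsto (fun i => eLpNorm (w i - v) 2 timeMeasure) atTop (𝓝 0))
    {a : ℕ → ℝ≥0∞} {a' : ℝ≥0∞} (ha : Tendsto a atTop (𝓝 a')) (ha' : a' ≠ ∞)
    (hle : ∀ i, eLpNorm (errorSystem F h L b K (w i)) 2 timeMeasure ≤
      a i * eLpNorm (w i) 2 timeMeasure) :
    eLpNorm (errorSystem F h L b K v) 2 timeMeasure ≤ a' * eLpNorm v 2 timeMeasure := by
  have h1 : Tendsto (fun i => a i * (eLpNorm v 2 timeMeasure + eLpNorm (w i - v) 2 timeMeasure))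
      atTop (𝓝 (a' * eLpNorm v 2 timeMeasure)) := by
    have := ENNReal.Tendsto.mul ha (Or.inr (by simpa using hv.2.ne)) (tendsto_const_nhds.add hlim)
      (Or.inr ha')
    simpa using this
  -- Fatou: pointwise convergence of the outputs suffices.
  refine (Lp.eLpNorm_lim_le_liminf_eLpNorm
    (fun i => aestronglyMeasurable_errorSystem F h L K (hw i).1) _
    (ae_of_all _ fun t => tendsto_errorSystem hF hh hK hw hv hlim t)).trans ?_
  rw [← h1.liminf_eq]
  refine liminf_le_liminf (Eventually.of_forall fun i => (hle i).trans ?_)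
  gcongr
  calc eLpNorm (w i) 2 timeMeasure = eLpNorm (v + (w i - v)) 2 timeMeasure := by
        rw [add_sub_cancel]
    _ ≤ _ := eLpNorm_add_le hv.1 ((hw i).sub hv).1 (by norm_num)

end ErrorSystem

/-! ### Approximation by held samples -/

section Approximation

variable {g : ℝ → ℝ}

lemma tendsto_hold_sampler (hg : Continuous g) (hgc : HasCompactSupport g) {τ : ℕ → ℝ}
    (hτ : ∀ i, 0 < τ i) (hlim : Tendsto τ atTop (𝓝 0)) :
    Tendsto (fun i => eLpNorm (hold (τ i) (sampler (τ i) g) - g) 2 timeMeasure) atTop (𝓝 0) := by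
  obtain ⟨R, -, hR⟩ := hgc.exists_pos_le_norm
  have huc := Metric.uniformContinuous_iff.1 (hgc.uniformContinuous_of_continuous hg)
  -- The margin 1 exceeds the sampling period eventually: for t > R + 1 the last sampling instant is
  -- still beyond R, so both signals vanish there.
  have hC : timeMeasure (Set.Icc 0 (R + 1)) ^ (1 / (2 : ℝ≥0∞).toReal) ≠ ∞ := by
    refine (ENNReal.rpow_lt_top_of_nonneg (by norm_num) ?_).ne
    exact ((Measure.restrict_le_self _).trans_lt measure_Icc_lt_top).ne
  refine ENNReal.tendsto_nhds_zero.2 fun ε hε => ?_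
  obtain ⟨η, hη, hηε⟩ := ENNReal.exists_nnreal_pos_mul_lt hC hε.ne'
  obtain ⟨δ, hδ, hd⟩ := huc η (by exact_mod_cast hη)
  filter_upwards [hlim.eventually_lt_const (lt_min hδ one_pos)] with i hi
  refine le_trans ?_ ((eLpNorm_indicator_const_le (c := (η : ℝ)) (μ := timeMeasure)
    (s := Set.Icc 0 (R + 1)) 2).trans (le_trans (le_of_eq ?_) hηε.le))
  · refine eLpNorm_mono_ae ((ae_restrict_iff' measurableSet_Ici).2 (ae_of_all _ fun t ht => ?_))
    have hfl : (⌊t / τ i⌋₊ : ℝ) * τ i ≤ t := by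
      rw [← le_div_iff₀ (hτ i)]
      exact Nat.floor_le (div_nonneg ht (hτ i).le)
    have hfl' : t < ((⌊t / τ i⌋₊ : ℝ) + 1) * τ i := by
      rw [← div_lt_iff₀ (hτ i)]
      exact Nat.lt_floor_add_one _
    have hi1 := hi.trans_le (min_le_left _ _)
    have hi2 := hi.trans_le (min_le_right _ _)
    change ‖g (⌊t / τ i⌋₊ * τ i) - g t‖ ≤ _
    by_cases htR : t ≤ R + 1
    · rw [Set.indicator_of_mem (show t ∈ Set.Icc 0 (R + 1) from ⟨ht, htR⟩), ← dist_eq_norm,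
        Real.norm_of_nonneg η.coe_nonneg]
      refine (hd ?_).le
      rw [Real.dist_eq, abs_sub_lt_iff]
      constructor <;> linarith
    · rw [hR t ((le_abs_self t).trans' (by linarith)),
        hR _ ((le_abs_self ((⌊t / τ i⌋₊ : ℝ) * τ i)).trans' (by linarith))]
      simp
  · congr 1
    simp

lemma l2Norm_sampler_ne_top (hgc : HasCompactSupport g) {τ : ℝ} (hτ : 0 < τ) :
    l2Norm (sampler τ g) ≠ ∞ := by
  obtain ⟨R, -, hR⟩ := hgc.exists_pos_le_norm
  rw [l2Norm_real]
  refine (ENNReal.rpow_lt_top_of_nonneg (by norm_num) ?_).ne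
  rw [tsum_eq_sum (s := Finset.range (⌊R / τ⌋₊ + 1))]
  · exact (ENNReal.sum_lt_top.2 fun i _ => by simp).ne
  · intro k hk
    have h1 : ⌊R / τ⌋₊ < k := by simpa [Nat.lt_succ_iff] using hk
    have h2 : R < k * τ := by
      rw [← div_lt_iff₀ hτ]
      exact Nat.lt_of_floor_lt h1
    simp [sampler, hR _ (h2.le.trans (le_abs_self _))]

lemma memLp_hold {τ : ℝ} (hτ : 0 < τ) {u : ℕ → ℝ} (hu : l2Norm u ≠ ∞) :
    MemLp (hold τ u) 2 timeMeasure := by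
  refine ⟨(measurable_hold τ u).aestronglyMeasurable, ?_⟩
  rw [eLpNorm_hold hτ]
  exact ENNReal.mul_lt_top (ENNReal.rpow_lt_top_of_nonneg (by norm_num) ENNReal.ofReal_ne_top)
    hu.lt_top

lemma exists_continuous_tendsto {w : ℝ → ℝ} (hw : MemLp w 2 timeMeasure) :
    ∃ g : ℕ → ℝ → ℝ, (∀ i, Continuous (g i) ∧ HasCompactSupport (g i) ∧
      MemLp (g i) 2 timeMeasure) ∧
      Tendsto (fun i => eLpNorm (g i - w) 2 timeMeasure) atTop (𝓝 0) := by
  have hw' : MemLp ((Set.Ici 0).indicator w) 2 volume :=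
    (memLp_indicator_iff_restrict measurableSet_Ici).2 hw
  choose g hg1 hg2 hg3 hg4 using fun i : ℕ => hw'.exists_hasCompactSupport_eLpNorm_sub_le
    (by norm_num) (ε := ((i : ℝ≥0∞) + 1)⁻¹) (by simp)
  refine ⟨g, fun i => ⟨hg3 i, hg1 i, (hg4 i).mono_measure Measure.restrict_le_self⟩, ?_⟩
  have h0 : Tendsto (fun i : ℕ => ((i : ℝ≥0∞) + 1)⁻¹) atTop (𝓝 0) := by
    have := (tendsto_add_atTop_iff_nat 1).2 ENNReal.tendsto_inv_nat_nhds_zero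
    simpa using this
  refine tendsto_of_tendsto_of_tendsto_of_le_of_le tendsto_const_nhds h0 (fun _ => zero_le)
    fun i => le_trans ?_ (hg2 i)
  rw [eLpNorm_sub_comm]
  refine le_trans (le_of_eq (eLpNorm_congr_ae ?_)) (eLpNorm_mono_measure _ Measure.restrict_le_self)
  refine (ae_restrict_iff' measurableSet_Ici).2 (ae_of_all _ fun t ht => ?_)
  simp [Set.indicator_of_mem ht]

end Approximation

/-! ### Induced norms of the error system and of its fast discretizations -/

section InducedNorm

lemma l2Norm_real_eq_zero {x : ℕ → ℝ} (h : l2Norm x = 0) : x = 0 := by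
  rw [← l2Norm_dlift 1] at h
  rw [← idlift_dlift 1 x, l2Norm_eq_zero h]
  rfl

lemma eLpNorm_le_continuousHinfNorm_mul (T : (ℝ → ℝ) → (ℝ → ℝ)) {w : ℝ → ℝ}
    (hw : MemLp w 2 timeMeasure) (h0 : eLpNorm w 2 timeMeasure ≠ 0) :
    eLpNorm (T w) 2 timeMeasure ≤ continuousHinfNorm T * eLpNorm w 2 timeMeasure := by
  rw [← ENNReal.div_le_iff h0 hw.2.ne]
  exact le_iSup₂_of_le w hw (le_iSup_of_le h0 le_rfl)

variable {F : CTSystem} {h L : ℝ} {m M : ℕ} [NeZero M] {b : Fin M → Bool}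
  {K : (ℕ → (Fin (numOnes b) → ℝ)) → (ℕ → (Fin M → ℝ))}

lemma discreteHinfNorm_fastSystem (F : CTSystem) (hh : 0 < h) (hL : L = m * h)
    (K : (ℕ → (Fin (numOnes b) → ℝ)) → (ℕ → (Fin M → ℝ))) (n : ℕ) [NeZero n] :
    discreteHinfNorm (fastSystem F h m b K n) =
      discreteHinfNorm (ctd (h / n) (errorSystem F h L b K)) := by
  rw [fastSystem_eq F hh hL K n, discreteHinfNorm_lift, discreteHinfNorm_lift]

/-- The induced norm says nothing about the zero input, which must be handled by linearity. -/
lemma ctd_errorSystem_zero (F : CTSystem) (hh : 0 < h) (hL : L = m * h) (hK : IsLTI K) (n : ℕ)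
    [NeZero n] : ctd (h / n) (errorSystem F h L b K) 0 = 0 := by
  have h0 := (isLTI_fastSystem F hh m hK n).map_zero
  rw [fastSystem_eq F hh hL K n] at h0
  have h1 : dlift M (dlift n (ctd (h / n) (errorSystem F h L b K) 0)) = 0 := h0
  rw [← idlift_dlift n (ctd _ _ _), ← idlift_dlift M (dlift n _), h1]
  rfl

/-- Numerator and denominator are multiplied by √τ to become norms of held signals; then H S T w = T
w − (T w − H S T w). -/
lemma discreteHinfNorm_fastSystem_le (hh : 0 < h) (hL : L = m * h) {n : ℕ} [NeZero n]
    {c : ℝ≥0∞} (hc : ∀ w : ℝ → ℝ, MemLp w 2 timeMeasure →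
      eLpNorm (errorSystem F h L b K w -
        hold (h / n) (sampler (h / n) (errorSystem F h L b K w))) 2 timeMeasure ≤
      c * eLpNorm w 2 timeMeasure) :
    discreteHinfNorm (fastSystem F h m b K n) ≤
      continuousHinfNorm (errorSystem F h L b K) + c := by
  have hτ : 0 < h / n := div_pos hh (by exact_mod_cast Nat.pos_of_neZero n)
  have hs0 : ENNReal.ofReal (h / n) ^ (1 / 2 : ℝ) ≠ 0 := by simp [hτ]
  have hs1 : ENNReal.ofReal (h / n) ^ (1 / 2 : ℝ) ≠ ∞ := by simp
  rw [discreteHinfNorm_fastSystem F hh hL K n]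
  refine iSup_le fun u => iSup_le fun h0 => iSup_le fun h1 => ?_
  have hw := memLp_hold hτ h1
  have hw0 : eLpNorm (hold (h / n) u) 2 timeMeasure ≠ 0 := by
    rw [eLpNorm_hold hτ]
    exact mul_ne_zero hs0 h0
  rw [← ENNReal.mul_div_mul_left _ _ hs0 hs1, ← eLpNorm_hold hτ, ← eLpNorm_hold hτ,
    ENNReal.div_le_iff hw0 hw.2.ne]
  set T := errorSystem F h L b K
  set w := hold (h / n) u
  have hT := aestronglyMeasurable_errorSystem F h L K hw.1
  have hH := (measurable_hold (h / n) (sampler (h / n) (T w))).aestronglyMeasurable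
    (μ := timeMeasure)
  calc eLpNorm (hold (h / n) (sampler (h / n) (T w))) 2 timeMeasure
      = eLpNorm (T w - (T w - hold (h / n) (sampler (h / n) (T w)))) 2 timeMeasure := by
        rw [sub_sub_cancel]
    _ ≤ eLpNorm (T w) 2 timeMeasure +
        eLpNorm (T w - hold (h / n) (sampler (h / n) (T w))) 2 timeMeasure :=
        eLpNorm_sub_le hT (hT.sub hH) (by norm_num)
    _ ≤ continuousHinfNorm T * eLpNorm w 2 timeMeasure + c * eLpNorm w 2 timeMeasure :=
        add_le_add (eLpNorm_le_continuousHinfNorm_mul T hw hw0) (hc w hw)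
    _ = _ := by rw [add_mul]

lemma eLpNorm_errorSystem_hold_le (hh : 0 < h) (hL : L = m * h) (hK : IsLTI K) {n : ℕ} [NeZero n]
    {c : ℝ≥0∞} (hc : ∀ w : ℝ → ℝ, MemLp w 2 timeMeasure →
      eLpNorm (errorSystem F h L b K w -
        hold (h / n) (sampler (h / n) (errorSystem F h L b K w))) 2 timeMeasure ≤
      c * eLpNorm w 2 timeMeasure) {u : ℕ → ℝ} (hu : l2Norm u ≠ ∞) :
    eLpNorm (errorSystem F h L b K (hold (h / n) u)) 2 timeMeasure ≤
      (discreteHinfNorm (fastSystem F h m b K n) + c) * eLpNorm (hold (h / n) u) 2 timeMeasure := by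
  have hτ : 0 < h / n := div_pos hh (by exact_mod_cast Nat.pos_of_neZero n)
  have hw := memLp_hold hτ hu
  have h1 : l2Norm (ctd (h / n) (errorSystem F h L b K) u) ≤
      discreteHinfNorm (ctd (h / n) (errorSystem F h L b K)) * l2Norm u := by
    by_cases h0 : l2Norm u = 0
    · rw [l2Norm_real_eq_zero h0, ctd_errorSystem_zero F hh hL hK n]
      simp [l2Norm_real]
    · exact l2Norm_le_discreteHinfNorm_mul _ h0 hu
  set T := errorSystem F h L b K
  set w := hold (h / n) u with hwdef
  have hT := aestronglyMeasurable_errorSystem F h L K hw.1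
  have hH := (measurable_hold (h / n) (sampler (h / n) (T w))).aestronglyMeasurable
    (μ := timeMeasure)
  calc eLpNorm (T w) 2 timeMeasure
      = eLpNorm (hold (h / n) (sampler (h / n) (T w)) +
          (T w - hold (h / n) (sampler (h / n) (T w)))) 2 timeMeasure := by rw [add_sub_cancel]
    _ ≤ eLpNorm (hold (h / n) (sampler (h / n) (T w))) 2 timeMeasure +
        eLpNorm (T w - hold (h / n) (sampler (h / n) (T w))) 2 timeMeasure :=
        eLpNorm_add_le hH (hT.sub hH) (by norm_num)
    _ ≤ discreteHinfNorm (ctd (h / n) T) * eLpNorm w 2 timeMeasure +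
        c * eLpNorm w 2 timeMeasure := by
        refine add_le_add ?_ (hc w hw)
        rw [eLpNorm_hold hτ, hwdef, eLpNorm_hold hτ, mul_left_comm]
        gcongr
        exact h1
    _ = _ := by rw [discreteHinfNorm_fastSystem F hh hL K n, add_mul]

/-- Two passages to the limit: from held samples to continuous compactly supported inputs, then from
these to all of L². -/
lemma continuousHinfNorm_errorSystem_le (hF : F.IsStable) (hh : 0 < h) (hL : L = m * h)
    (hK : IsLTI K) {ns : ℕ → ℕ+} (hns : Tendsto ns atTop atTop) {a : ℝ≥0∞} (ha : a ≠ ∞)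
    (hle : ∀ i, discreteHinfNorm (fastSystem F h m b K (ns i)) ≤ a) :
    continuousHinfNorm (errorSystem F h L b K) ≤ a := by
  obtain ⟨c, hc, hb⟩ := exists_errorSystem_sub_hold_bound hF hh hL K
  have hτ0 : ∀ i, 0 < h / (ns i : ℕ) := fun i => div_pos hh (by exact_mod_cast (ns i).pos)
  have hτ : Tendsto (fun i => h / ((ns i : ℕ) : ℝ)) atTop (𝓝 0) :=
    tendsto_const_nhds.div_atTop
      (tendsto_natCast_atTop_atTop.comp (tendsto_PNat_val_atTop_atTop.comp hns))
  have hlim : Tendsto (fun i => a + ENNReal.ofReal (h / (ns i : ℕ)) * c) atTop (𝓝 a) := by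
    have h1 := ENNReal.Tendsto.mul_const (ENNReal.tendsto_ofReal hτ) (Or.inr hc)
    simpa using tendsto_const_nhds.add h1
  have hcont : ∀ g : ℝ → ℝ, Continuous g → HasCompactSupport g → MemLp g 2 timeMeasure →
      eLpNorm (errorSystem F h L b K g) 2 timeMeasure ≤ a * eLpNorm g 2 timeMeasure := by
    intro g hg hgc hgm
    refine eLpNorm_errorSystem_le_of_tendsto hF hh.le hK
      (fun i => memLp_hold (hτ0 i) (l2Norm_sampler_ne_top hgc (hτ0 i))) hgm
      (tendsto_hold_sampler hg hgc hτ0 hτ) hlim ha fun i => ?_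
    refine (eLpNorm_errorSystem_hold_le hh hL hK (hb (ns i))
      (l2Norm_sampler_ne_top hgc (hτ0 i))).trans ?_
    gcongr
    exact hle i
  refine iSup_le fun w => iSup_le fun hw => iSup_le fun hw0 => ?_
  rw [ENNReal.div_le_iff hw0 hw.2.ne]
  obtain ⟨g, hg, hgw⟩ := exists_continuous_tendsto hw
  exact eLpNorm_errorSystem_le_of_tendsto hF hh.le hK (fun i => (hg i).2.2) hw hgw
    tendsto_const_nhds ha fun i => hcont _ (hg i).1 (hg i).2.1 (hg i).2.2

lemma tendsto_discreteHinfNorm_fastSystem (hF : F.IsStable) (hh : 0 < h) (hL : L = m * h)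
    (hK : IsLTI K) :
    Tendsto (fun n : ℕ+ => discreteHinfNorm (fastSystem F h m b K n)) atTop
      (𝓝 (continuousHinfNorm (errorSystem F h L b K))) := by
  -- Order neighbourhoods also cover an infinite limit. Failure of the lower bound gives arbitrarily
  -- large n with norm at most a < ∞, contradicting the previous lemma.
  refine tendsto_order.2 ⟨fun a ha => ?_, fun a ha => ?_⟩
  · by_contra hcon
    have hfreq : ∃ᶠ n : ℕ+ in atTop, discreteHinfNorm (fastSystem F h m b K n) ≤ a :=
      fun hev => hcon (hev.mono fun _ hn => not_le.1 hn)
    obtain ⟨ns, hns, hle⟩ := exists_seq_forall_of_frequently hfreq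
    exact ha.not_ge (continuousHinfNorm_errorSystem_le hF hh hL hK hns ha.ne_top hle)
  · obtain ⟨c, hc, hb⟩ := exists_errorSystem_sub_hold_bound hF hh hL K
    have hτ : Tendsto (fun n : ℕ+ => h / ((n : ℕ) : ℝ)) atTop (𝓝 0) :=
      tendsto_const_nhds.div_atTop
        (tendsto_natCast_atTop_atTop.comp tendsto_PNat_val_atTop_atTop)
    have hlim : Tendsto (fun n : ℕ+ => continuousHinfNorm (errorSystem F h L b K) +
        ENNReal.ofReal (h / (n : ℕ)) * c) atTop
        (𝓝 (continuousHinfNorm (errorSystem F h L b K))) := by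
      have h1 := ENNReal.Tendsto.mul_const (ENNReal.tendsto_ofReal hτ) (Or.inr hc)
      simpa using tendsto_const_nhds.add h1
    filter_upwards [hlim.eventually_lt_const ha] with n hn
    exact (discreteHinfNorm_fastSystem_le hh hL (hb n)).trans_lt hn

/-- The error system is bounded if the reconstruction filter is. -/
lemma continuousHinfNorm_errorSystem_ne_top (hF : F.IsStable) (hh : 0 < h) (L : ℝ)
    (hK : IsLTI K) (hKn : discreteHinfNorm K ≠ ∞) :
    continuousHinfNorm (errorSystem F h L b K) ≠ ∞ := by
  obtain ⟨c, hc, hb⟩ := hF.exists_response_bound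
  obtain ⟨c', hc', hb'⟩ := hF.exists_response_sub_hold_bound h
  set C := c + discreteHinfNorm K * (c + ENNReal.ofReal h * c') with hC
  have hCtop : C ≠ ∞ := ENNReal.add_ne_top.2 ⟨hc, ENNReal.mul_ne_top hKn
    (ENNReal.add_ne_top.2 ⟨hc, ENNReal.mul_ne_top ENNReal.ofReal_ne_top hc'⟩)⟩
  refine ne_top_of_le_ne_top hCtop (iSup_le fun w => iSup_le fun hw => iSup_le fun hw0 => ?_)
  rw [ENNReal.div_le_iff hw0 hw.2.ne]
  set y := F.response w
  have hy := F.aestronglyMeasurable_response hw.1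
  have hH : ∀ x : ℕ → ℝ, AEStronglyMeasurable (hold h x) timeMeasure := fun x =>
    (measurable_hold h x).aestronglyMeasurable
  set s := ENNReal.ofReal h ^ (1 / 2 : ℝ) with hs
  have hs0 : s ≠ 0 := by simp [hs, hh]
  set v := select b (dlift M (sampler h y)) with hv
  -- Sampling alone is not bounded on L², but sampling after F is: the held samples differ from y by
  -- the sampling error, here taken with τ = h.
  have h1 : s * l2Norm v ≤ (c + ENNReal.ofReal h * c') * eLpNorm w 2 timeMeasure := by
    calc s * l2Norm v ≤ s * l2Norm (sampler h y) := by
          gcongr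
          exact (l2Norm_select_le b _).trans_eq (l2Norm_dlift M _)
      _ = eLpNorm (hold h (sampler h y)) 2 timeMeasure := (eLpNorm_hold hh _).symm
      _ = eLpNorm (y - (y - hold h (sampler h y))) 2 timeMeasure := by rw [sub_sub_cancel]
      _ ≤ eLpNorm y 2 timeMeasure + eLpNorm (y - hold h (sampler h y)) 2 timeMeasure :=
          eLpNorm_sub_le hy (hy.sub (hH _)) (by norm_num)
      _ ≤ c * eLpNorm w 2 timeMeasure + ENNReal.ofReal h * c' * eLpNorm w 2 timeMeasure :=
          add_le_add (hb w hw.1).1 (hb' h hh le_rfl w hw)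
      _ = _ := by rw [add_mul]
  have hv1 : l2Norm v ≠ ∞ := by
    intro htop
    rw [htop, ENNReal.mul_top hs0, top_le_iff] at h1
    exact ENNReal.mul_ne_top (ENNReal.add_ne_top.2
      ⟨hc, ENNReal.mul_ne_top ENNReal.ofReal_ne_top hc'⟩) hw.2.ne h1
  have h2 : l2Norm (K v) ≤ discreteHinfNorm K * l2Norm v := by
    by_cases h0 : l2Norm v = 0
    · rw [l2Norm_eq_zero h0, hK.map_zero, ← l2Norm_idlift]
      have : idlift M (0 : ℕ → Fin M → ℝ) = 0 := rfl
      simp [this, l2Norm_real]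
    · exact l2Norm_le_discreteHinfNorm_mul K h0 hv1
  calc eLpNorm (errorSystem F h L b K w) 2 timeMeasure
      ≤ eLpNorm (ctDelay L y) 2 timeMeasure + eLpNorm (hold h (idlift M (K v))) 2 timeMeasure :=
        eLpNorm_sub_le (aestronglyMeasurable_ctDelay L hy) (hH _) (by norm_num)
    _ ≤ c * eLpNorm w 2 timeMeasure +
        discreteHinfNorm K * ((c + ENNReal.ofReal h * c') * eLpNorm w 2 timeMeasure) := by
        refine add_le_add ((eLpNorm_ctDelay_le L hy).trans (hb w hw.1).1) ?_
        rw [eLpNorm_hold hh, l2Norm_idlift]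
        calc s * l2Norm (K v) ≤ s * (discreteHinfNorm K * l2Norm v) := by gcongr
          _ = discreteHinfNorm K * (s * l2Norm v) := mul_left_comm _ _ _
          _ ≤ _ := by gcongr
    _ = _ := by rw [hC]; ring

end InducedNorm

end SampledData

theorem mainTheorem4 (F : SampledData.CTSystem) (hF : F.IsStable)
    (h : ℝ) (hh : 0 < h) (L : ℝ) (m : ℕ) (hL : L = m * h)
    (M : ℕ) [NeZero M] (b : Fin M → Bool)
    (K : (ℕ → (Fin (SampledData.numOnes b) → ℝ)) → (ℕ → (Fin M → ℝ)))
    (hK : SampledData.IsLTI K) :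
    (∀ n : ℕ+,
      SampledData.IsLTI (SampledData.fastSystem F h m b K n) ∧
      (SampledData.IsFiniteDimensional K →
        SampledData.IsFiniteDimensional (SampledData.fastSystem F h m b K n)) ∧
      SampledData.fastSystem F h m b K n =
        SampledData.lift M (SampledData.lift n
          (SampledData.ctd (h / (n : ℕ)) (SampledData.errorSystem F h L b K)))) ∧
    (SampledData.discreteHinfNorm K ≠ ∞ →
      SampledData.continuousHinfNorm (SampledData.errorSystem F h L b K) ≠ ∞) ∧
    Tendsto (fun n : ℕ+ => SampledData.discreteHinfNorm (SampledData.fastSystem F h m b K n))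
      atTop (𝓝 (SampledData.continuousHinfNorm (SampledData.errorSystem F h L b K))) :=
  ⟨fun n => ⟨SampledData.isLTI_fastSystem F hh m hK n,
    fun hKf => SampledData.isFiniteDimensional_fastSystem F hh m hKf n,
    SampledData.fastSystem_eq F hh hL K n⟩,
    SampledData.continuousHinfNorm_errorSystem_ne_top hF hh L hK,
    SampledData.tendsto_discreteHinfNorm_fastSystem hF hh hL hK⟩
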